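/- Let $z,z'\in\mathbb C$ satisfy one of the following: (i) $z'=\bar z$ and $z\notin\mathbb Z$; (ii) $z,z'$ are real and $m<z,z'<m+1$ for some $m\in\mathbb Z$. Put $$a=\tfrac{z+z'}2,\qquad \mu=\tfrac{z-z'}2,\qquad \sigma=\sqrt{\sin(\pi z)\sin(\pi z')}>0,\qquad c=\frac{2\mu\sigma^2}{\pi\sin(2\pi\mu)}>0 .$$ Let $W_{\kappa,\mu}$ be the Whittaker function on $(0,\infty)$, i.e. the only solution of $y''-\bigl(\frac14-\frac{\kappa}{x}+\frac{\mu^2-1/4}{x^2}\bigr)y=0$ with $y(x)\sim x^{\kappa}e^{-x/2}$ as $x\to+\infty$, and put $$A_\pm(x)=x^{-1/2}W_{\pm a+\frac12,\mu}(x),\qquad B_\pm(x)=x^{-1/2}W_{\pm a-\frac12,\mu}(x).$$ The matrix Whittaker kernel is $K=\begin{bmatrix}K_{++}&K_{+-}\\K_{-+}&K_{--}\end{bmatrix}$, where for $x,y>0$ $$K_{++}(x,y)=\frac{1}{\Gamma(z)\Gamma(z')}\,\frac{A_+(x)B_+(y)-B_+(x)A_+(y)}{x-y},\qquad K_{--}(x,y)=\frac{1}{\Gamma(-z)\Gamma(-z')}\,\frac{A_-(x)B_-(y)-B_-(x)A_-(y)}{x-y},$$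 $$K_{+-}(x,y)=\frac{\sigma}{\pi}\,\frac{A_+(x)A_-(y)+zz'B_+(x)B_-(y)}{x+y},\qquad K_{-+}(x,y)=-K_{+-}(y,x),$$ with $K_{++}$, $K_{--}$ extended to $x=y$ by continuity. Let $K'(\xi,\eta)=\frac{\sqrt{xy}}{c}\,K(x,y)$, $x=e^{-\xi/c}$, $y=e^{-\eta/c}$, be the kernel on $\mathbb R$ obtained from $K$ by the change of variable $x\mapsto\xi=-c\ln x$ on each copy of $\mathbb R_+$. Then for all $\xi,\eta\in\mathbb R$ the limit $\lim_{M\to+\infty}K'(\xi+M,\eta+M)=\mathcal K(\xi,\eta)$ exists. The kernel $\mathcal K$ is translation invariant, its diagonal blocks satisfy $\mathcal K_{++}(\xi,\xi)=\mathcal K_{--}(\xi,\xi)=1$, and $$\mathcal K(\xi,\eta)=\begin{bmatrix}F(\xi-\eta)&G(\xi-\eta)\\-G(\eta-\xi)&F(\xi-\eta)\end{bmatrix},$$ $$F(\zeta)=\frac BA\,\frac{\sinh(A\zeta)}{\sinh(B\zeta)},\qquad G(\zeta)=\frac{1}{2\mu\sigma}\,\frac{\sin(\pi\mu)\cos(\pi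 a)\cosh(A\zeta)-\sin(\pi a)\cos(\pi\mu)\sinh(A\zeta)}{\cosh(B\zeta)},$$ where $$B=\frac{\pi\sin(2\pi\mu)}{4\mu\sigma^2}>0,\qquad A=2\mu B=\frac{\pi\sin(2\pi\mu)}{2\sigma^2}.$$ Here $F(0)=1$, and for $\mu=0$ (that is, $z=z'$) the expressions are understood as their limits as $\mu\to0$: $c=\sigma^2/\pi^2$, $B=\pi^2/(2\sigma^2)$, $A=0$, $F(\zeta)=B\zeta/\sinh(B\zeta)$ and $G(\zeta)=\frac1{2\sigma}\,\frac{\pi\cos(\pi a)-2B\zeta\sin(\pi a)}{\cosh(B\zeta)}$. -/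

import Mathlib

open Filter Topology Asymptotics

noncomputable section

namespace WhittakerTail

/-- `y` solves Whittaker's equation
`y'' - (1/4 - κ/x + (μ² - 1/4)/x²) y = 0` on `(0, ∞)` and `y(x) ∼ x^κ e^{-x/2}` as `x → +∞`. -/
structure IsWhittakerW (κ μ : ℂ) (y : ℝ → ℂ) : Prop where
  differentiable : ∀ x : ℝ, 0 < x → DifferentiableAt ℝ y x
  differentiable_deriv : ∀ x : ℝ, 0 < x → DifferentiableAt ℝ (deriv y) x
  equation : ∀ x : ℝ, 0 < x →
    deriv (deriv y) x - (1 / 4 - κ / (x : ℂ) + (μ ^ 2 - 1 / 4) / (x : ℂ) ^ 2) * y x = 0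
  asymptotics : y ~[atTop] fun x : ℝ => (x : ℂ) ^ κ * Complex.exp (-(x : ℂ) / 2)

/-- The Whittaker function `W_{κ,μ}` on `(0, ∞)`: the only solution (on `(0, ∞)`) of Whittaker's
equation with `W_{κ,μ}(x) ∼ x^κ e^{-x/2}` as `x → +∞`. Only its values on `(0, ∞)` are meaningful
and only these are used. -/
def whittakerW (κ μ : ℂ) : ℝ → ℂ :=
  Classical.epsilon (IsWhittakerW κ μ)

/-- The admissible parameters: either `z' = conj z` with `z` not an integer, or `z`, `z'` are real
and lie in a common open interval `(m, m + 1)` with `m` an integer. -/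
def Admissible (z z' : ℂ) : Prop :=
  (z' = (starRingEnd ℂ) z ∧ ∀ m : ℤ, z ≠ (m : ℂ)) ∨
  (∃ r r' : ℝ, z = (r : ℂ) ∧ z' = (r' : ℂ) ∧
    ∃ m : ℤ, (m : ℝ) < r ∧ r < m + 1 ∧ (m : ℝ) < r' ∧ r' < m + 1)

/-- `a = (z + z') / 2`. -/
def parA (z z' : ℂ) : ℂ := (z + z') / 2

/-- `μ = (z - z') / 2`. -/
def parMu (z z' : ℂ) : ℂ := (z - z') / 2

/-- `sin (π z) sin (π z')`, which is a positive real number for admissible parameters. -/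
def sinProd (z z' : ℂ) : ℂ := Complex.sin (Real.pi * z) * Complex.sin (Real.pi * z')

/-- `σ = √(sin (π z) sin (π z')) > 0`. -/
def sigma (z z' : ℂ) : ℝ := Real.sqrt (sinProd z z').re

/-- `A₊(x) = x^{-1/2} W_{a+1/2,μ}(x)`. -/
def Aplus (z z' : ℂ) (x : ℝ) : ℂ :=
  ((Real.sqrt x)⁻¹ : ℝ) * whittakerW (parA z z' + 1 / 2) (parMu z z') x

/-- `A₋(x) = x^{-1/2} W_{-a+1/2,μ}(x)`. -/
def Aminus (z z' : ℂ) (x : ℝ) : ℂ :=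
  ((Real.sqrt x)⁻¹ : ℝ) * whittakerW (-parA z z' + 1 / 2) (parMu z z') x

/-- `B₊(x) = x^{-1/2} W_{a-1/2,μ}(x)`. -/
def Bplus (z z' : ℂ) (x : ℝ) : ℂ :=
  ((Real.sqrt x)⁻¹ : ℝ) * whittakerW (parA z z' - 1 / 2) (parMu z z') x

/-- `B₋(x) = x^{-1/2} W_{-a-1/2,μ}(x)`. -/
def Bminus (z z' : ℂ) (x : ℝ) : ℂ :=
  ((Real.sqrt x)⁻¹ : ℝ) * whittakerW (-parA z z' - 1 / 2) (parMu z z') x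

/-- `(f(x) g(y) - g(x) f(y)) / (x - y)`, extended to `x = y` by continuity. -/
def divDiffKernel (f g : ℝ → ℂ) (x y : ℝ) : ℂ :=
  if x = y then deriv f x * g x - deriv g x * f x
  else (f x * g y - g x * f y) / ((x : ℂ) - (y : ℂ))

/-- The block `K₊₊` of the matrix Whittaker kernel. -/
def Kpp (z z' : ℂ) (x y : ℝ) : ℂ :=
  1 / (Complex.Gamma z * Complex.Gamma z') * divDiffKernel (Aplus z z') (Bplus z z') x y

/-- The block `K₊₋` of the matrix Whittaker kernel. -/
def Kpm (z z' : ℂ) (x y : ℝ) : ℂ :=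
  (sigma z z' : ℂ) / (Real.pi : ℂ) *
    ((Aplus z z' x * Aminus z z' y + z * z' * (Bplus z z' x * Bminus z z' y)) /
      ((x : ℂ) + (y : ℂ)))

/-- The block `K₋₊` of the matrix Whittaker kernel. -/
def Kmp (z z' : ℂ) (x y : ℝ) : ℂ :=
  -((sigma z z' : ℂ) / (Real.pi : ℂ)) *
    ((Aplus z z' y * Aminus z z' x + z * z' * (Bplus z z' y * Bminus z z' x)) /
      ((x : ℂ) + (y : ℂ)))

/-- The block `K₋₋` of the matrix Whittaker kernel. -/
def Kmm (z z' : ℂ) (x y : ℝ) : ℂ :=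
  1 / (Complex.Gamma (-z) * Complex.Gamma (-z')) *
    divDiffKernel (Aminus z z') (Bminus z z') x y

/-- The matrix Whittaker kernel on two copies of `(0, ∞)`; index `0` is `+`, index `1` is `-`. -/
def whittakerKernel (z z' : ℂ) (x y : ℝ) : Matrix (Fin 2) (Fin 2) ℂ :=
  !![Kpp z z' x y, Kpm z z' x y;
     Kmp z z' x y, Kmm z z' x y]

/-- `2 μ σ² / (π sin (2πμ))`, with its limit value `σ² / π²` at `μ = 0`. -/
def scaleComplex (z z' : ℂ) : ℂ :=
  if parMu z z' = 0 then (sigma z z' : ℂ) ^ 2 / (Real.pi : ℂ) ^ 2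
  else 2 * parMu z z' * (sigma z z' : ℂ) ^ 2 /
    ((Real.pi : ℂ) * Complex.sin (2 * Real.pi * parMu z z'))

/-- The constant `c`: `scaleComplex` is a positive real number for admissible parameters. -/
def scale (z z' : ℂ) : ℝ := (scaleComplex z z').re

/-- The inverse `ξ ↦ x = e^{-ξ/c}` of the change of variable `x ↦ ξ = -c ln x`. -/
def expVar (c ξ : ℝ) : ℝ := Real.exp (-ξ / c)

/-- The matrix Whittaker kernel in the variables `ξ = -c ln x`, `η = -c ln y`:
`K'(ξ, η) = |dx/dξ|^{1/2} |dy/dη|^{1/2} K(x, y)`, where `|dx/dξ| = x / c`. -/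
def whittakerKernelLog (z z' : ℂ) (ξ η : ℝ) : Matrix (Fin 2) (Fin 2) ℂ :=
  ((Real.sqrt (expVar (scale z z') ξ / scale z z') *
      Real.sqrt (expVar (scale z z') η / scale z z') : ℝ) : ℂ) •
    whittakerKernel z z' (expVar (scale z z') ξ) (expVar (scale z z') η)

/-- `π sin (2πμ) / (4 μ σ²)`, with its limit value `π² / (2 σ²)` at `μ = 0`. -/
def constBComplex (z z' : ℂ) : ℂ :=
  if parMu z z' = 0 then (Real.pi : ℂ) ^ 2 / (2 * (sigma z z' : ℂ) ^ 2)
  else (Real.pi : ℂ) * Complex.sin (2 * Real.pi * parMu z z') /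
    (4 * parMu z z' * (sigma z z' : ℂ) ^ 2)

/-- The constant `B`: `constBComplex` is a positive real number for admissible parameters. -/
def constB (z z' : ℂ) : ℝ := (constBComplex z z').re

/-- The constant `A = π sin (2πμ) / (2 σ²)`, which is real or purely imaginary. -/
def constA (z z' : ℂ) : ℂ :=
  (Real.pi : ℂ) * Complex.sin (2 * Real.pi * parMu z z') / (2 * (sigma z z' : ℂ) ^ 2)

/-- `F(ζ) = (B/A) sinh(Aζ) / sinh(Bζ)`, with the limit values `1` at `ζ = 0` and
`Bζ / sinh(Bζ)` when `μ = 0` (then `A = 0`). -/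
def tailF (z z' : ℂ) (ζ : ℝ) : ℂ :=
  if ζ = 0 then 1
  else if parMu z z' = 0 then
    (constB z z' : ℂ) * ζ / Complex.sinh (constB z z' * ζ)
  else (constB z z' : ℂ) / constA z z' *
    (Complex.sinh (constA z z' * ζ) / Complex.sinh (constB z z' * ζ))

/-- `G(ζ) = (1/(2μσ)) (sin(πμ) cos(πa) cosh(Aζ) - sin(πa) cos(πμ) sinh(Aζ)) / cosh(Bζ)`, with the
limit value `(1/(2σ)) (π cos(πa) - 2Bζ sin(πa)) / cosh(Bζ)` when `μ = 0`. -/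
def tailG (z z' : ℂ) (ζ : ℝ) : ℂ :=
  if parMu z z' = 0 then
    1 / (2 * (sigma z z' : ℂ)) *
      (((Real.pi : ℂ) * Complex.cos (Real.pi * parA z z')
        - 2 * (constB z z' : ℂ) * ζ * Complex.sin (Real.pi * parA z z'))
        / Complex.cosh (constB z z' * ζ))
  else
    1 / (2 * parMu z z' * (sigma z z' : ℂ)) *
      ((Complex.sin (Real.pi * parMu z z') * Complex.cos (Real.pi * parA z z')
            * Complex.cosh (constA z z' * ζ)
        - Complex.sin (Real.pi * parA z z') * Complex.cos (Real.pi * parMu z z')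
            * Complex.sinh (constA z z' * ζ))
        / Complex.cosh (constB z z' * ζ))

end WhittakerTail

end

/-! The functions `A(x) = x^{-1/2} W_{a+1/2,μ}(x)` and `B(x) = x^{-1/2} W_{a-1/2,μ}(x)` solve a
first-order linear system, and as `M → ∞` both arguments of the kernel tend to `0` with the fixed
ratio `x / y = e^{-(ξ-η)/c}`, so only the leading behaviour of `A` and `B` at `0` matters.
Admissible parameters have `|re μ| < 1/2`, and then
`A(x) = C cosh(μ log x) + S sinh(μ log x) / μ + O(x^{1/2})`, where `μ C` is the odd part and `-S`
the even part of `s ↦ Γ(1 + 2s) / Γ(s - a)` at `s = μ`. The basis `cosh(μ log x)`,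
`sinh(μ log x) / μ` keeps the coefficients finite at `μ = 0`, where `W` acquires a logarithm.
The expansion is read off from Tricomi's Laplace integral for `W` when `re (μ - a) ≥ 2`, and
reaches all `a` through the contiguity relation `a ↦ a + 1`.

In the limit the addition theorems turn the bilinear combinations of `A` and `B` into functions of
`log (x / y)`, and the reflection formula evaluates their coefficients. On the diagonal the
derivatives of `A` and `B` come from the first-order system. -/

noncomputable section

namespace WhittakerTail

open MeasureTheory Set

section LinearODE

theorem wronskian_eqOn_const {y₁ y₂ q : ℝ → ℂ} {s : Set ℝ} (hs : Convex ℝ s)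
    (h₁ : ∀ x ∈ s, DifferentiableAt ℝ y₁ x) (h₂ : ∀ x ∈ s, DifferentiableAt ℝ y₂ x)
    (h₁' : ∀ x ∈ s, HasDerivAt (deriv y₁) (q x * y₁ x) x)
    (h₂' : ∀ x ∈ s, HasDerivAt (deriv y₂) (q x * y₂ x) x) {x₀ x : ℝ} (hx₀ : x₀ ∈ s) (hx : x ∈ s) :
    y₁ x * deriv y₂ x - deriv y₁ x * y₂ x = y₁ x₀ * deriv y₂ x₀ - deriv y₁ x₀ * y₂ x₀ := by
  have hderiv : ∀ t ∈ s, HasDerivWithinAt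
      (fun t => y₁ t * deriv y₂ t - deriv y₁ t * y₂ t) 0 s t := fun t ht =>
    ((((h₁ t ht).hasDerivAt.mul (h₂' t ht)).sub
      ((h₁' t ht).mul (h₂ t ht).hasDerivAt)).congr_deriv (by ring)).hasDerivWithinAt
  simpa [sub_eq_zero] using
    hs.norm_image_sub_le_of_norm_hasDerivWithin_le (C := 0) hderiv (by simp) hx₀ hx

theorem eqOn_Icc_of_deriv_deriv_eq_mul {y₁ y₂ q : ℝ → ℂ} {x X : ℝ} (hq : ContinuousOn q (Icc x X))
    (h₁ : ∀ t ∈ Icc x X, DifferentiableAt ℝ y₁ t) (h₂ : ∀ t ∈ Icc x X, DifferentiableAt ℝ y₂ t)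
    (h₁' : ∀ t ∈ Icc x X, HasDerivAt (deriv y₁) (q t * y₁ t) t)
    (h₂' : ∀ t ∈ Icc x X, HasDerivAt (deriv y₂) (q t * y₂ t) t)
    (hX : y₁ X = y₂ X) (hX' : deriv y₁ X = deriv y₂ X) : EqOn y₁ y₂ (Icc x X) := by
  obtain ⟨K, hK⟩ := isCompact_Icc.exists_bound_of_continuousOn hq
  have hlip : ∀ t ∈ Ioc x X, LipschitzOnWith (max 1 K.toNNReal)
      (fun u : ℂ × ℂ => (u.2, q t • u.1)) univ := fun t ht => by
    refine (LipschitzWith.weaken (LipschitzWith.prod_snd.prodMk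
      ((lipschitzWith_smul (q t)).comp LipschitzWith.prod_fst)) ?_).lipschitzOnWith
    rw [mul_one, ← norm_toNNReal]
    exact max_le_max le_rfl (Real.toNNReal_le_toNNReal (hK t (Ioc_subset_Icc_self ht)))
  have hsys : ∀ y : ℝ → ℂ, (∀ t ∈ Icc x X, DifferentiableAt ℝ y t) →
      (∀ t ∈ Icc x X, HasDerivAt (deriv y) (q t * y t) t) → ∀ t ∈ Icc x X,
      HasDerivAt (fun t => (y t, deriv y t)) (deriv y t, q t • y t) t :=
    fun y hy hy' t ht => (hy t ht).hasDerivAt.prodMk (hy' t ht)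
  have heq := ODE_solution_unique_of_mem_Icc_left hlip
    (fun t ht => (hsys y₁ h₁ h₁' t ht).continuousAt.continuousWithinAt)
    (fun t ht => (hsys y₁ h₁ h₁' t (Ioc_subset_Icc_self ht)).hasDerivWithinAt)
    (fun _ _ => mem_univ _)
    (fun t ht => (hsys y₂ h₂ h₂' t ht).continuousAt.continuousWithinAt)
    (fun t ht => (hsys y₂ h₂ h₂' t (Ioc_subset_Icc_self ht)).hasDerivWithinAt)
    (fun _ _ => mem_univ _) (Prod.ext hX hX')
  exact fun t ht => congrArg Prod.fst (heq ht)

theorem not_tendsto_nhds_of_tendsto_deriv_atTop {f f' : ℝ → ℝ}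
    (hf : ∀ᶠ x in atTop, HasDerivAt f (f' x) x) (hf' : Tendsto f' atTop atTop) (L : ℝ) :
    ¬Tendsto f atTop (𝓝 L) := fun hL => by
  have hstep : Tendsto (fun x => f (x + 1) - f x) atTop (𝓝 0) := by
    simpa using (hL.comp (tendsto_atTop_add_const_right _ 1 tendsto_id)).sub hL
  obtain ⟨T, hT⟩ := eventually_atTop.1 (hf.and (hf'.eventually_ge_atTop 1))
  obtain ⟨x, hxT, hx⟩ := ((eventually_ge_atTop T).and
    (hstep.eventually (gt_mem_nhds one_pos))).exists
  obtain ⟨u, hu, hslope⟩ := exists_hasDerivAt_eq_slope f f' (lt_add_one x)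
    (fun t ht => (hT t (hxT.trans ht.1)).1.continuousAt.continuousWithinAt)
    (fun t ht => (hT t (hxT.trans ht.1.le)).1)
  have := (hT u (hxT.trans hu.1.le)).2
  rw [hslope, add_sub_cancel_left, div_one] at this
  linarith

end LinearODE

section Uniqueness

variable {k : ℝ} {κ μ : ℂ} {y y₁ y₂ : ℝ → ℂ}

theorem IsWhittakerW.hasDerivAt_deriv (h : IsWhittakerW κ μ y) {x : ℝ} (hx : 0 < x) :
    HasDerivAt (deriv y) ((1 / 4 - κ / (x : ℂ) + (μ ^ 2 - 1 / 4) / (x : ℂ) ^ 2) * y x) x := by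
  rw [← sub_eq_zero.1 (h.equation x hx)]
  exact (h.differentiable_deriv x hx).hasDerivAt

theorem cpow_mul_exp_eq_ofReal (k : ℝ) {x : ℝ} (hx : 0 ≤ x) :
    (x : ℂ) ^ (k : ℂ) * Complex.exp (-(x : ℂ) / 2) = ((x ^ k * Real.exp (-x / 2) : ℝ) : ℂ) := by
  push_cast [Complex.ofReal_cpow hx]
  rfl

theorem cpow_mul_exp_ne_zero (κ : ℂ) {x : ℝ} (hx : 0 < x) :
    (x : ℂ) ^ κ * Complex.exp (-(x : ℂ) / 2) ≠ 0 :=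
  mul_ne_zero (by simp [Complex.cpow_eq_zero_iff, hx.ne']) (Complex.exp_ne_zero _)

theorem IsWhittakerW.eventually_ne_zero (h : IsWhittakerW κ μ y) : ∀ᶠ x in atTop, y x ≠ 0 := by
  filter_upwards [h.asymptotics.symm.isBigO.eq_zero_imp, eventually_gt_atTop 0] with x hx hx0 hy
  exact cpow_mul_exp_ne_zero κ hx0 (hx hy)

theorem IsWhittakerW.tendsto_re_inv_sq (h : IsWhittakerW k μ y) :
    Tendsto (fun x => ((y x ^ 2)⁻¹).re) atTop atTop := by
  have hgrow : Tendsto (fun x : ℝ => ((x ^ k * Real.exp (-x / 2)) ^ 2)⁻¹) atTop atTop := by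
    refine (tendsto_exp_div_rpow_atTop (2 * k)).congr' ?_
    filter_upwards [eventually_gt_atTop 0] with x hx
    rw [mul_pow, mul_inv, ← Real.exp_nat_mul, ← Real.exp_neg, two_mul, Real.rpow_add hx, sq,
      div_eq_inv_mul]
    push_cast
    ring_nf
  have hratio := (isEquivalent_iff_tendsto_one ((eventually_gt_atTop 0).mono
    fun x hx => cpow_mul_exp_ne_zero (k : ℂ) hx)).1 h.asymptotics
  have hre := (Complex.continuous_re.tendsto _).comp ((hratio.pow 2).inv₀ (by simp))
  rw [one_pow, inv_one, Complex.one_re] at hre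
  refine (hgrow.atTop_mul_pos one_pos hre).congr' ?_
  filter_upwards [eventually_gt_atTop 0] with x hx
  have hne : (((x ^ k * Real.exp (-x / 2)) ^ 2 : ℝ) : ℂ) ≠ 0 := Complex.ofReal_ne_zero.2
    (pow_pos (mul_pos (Real.rpow_pos_of_pos hx k) (Real.exp_pos _)) 2).ne'
  rw [Function.comp_apply, Pi.div_apply, cpow_mul_exp_eq_ofReal k hx.le, ← Complex.re_ofReal_mul,
    div_pow, inv_div, ← Complex.ofReal_pow, Complex.ofReal_inv, inv_mul_eq_div,
    div_div_cancel_left' hne]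

theorem IsWhittakerW.wronskian_eq_zero (h₁ : IsWhittakerW k μ y₁) (h₂ : IsWhittakerW k μ y₂)
    {x : ℝ} (hx : 0 < x) : y₁ x * deriv y₂ x - deriv y₁ x * y₂ x = 0 := by
  set C := y₁ x * deriv y₂ x - deriv y₁ x * y₂ x
  by_contra hC
  have hW : ∀ t : ℝ, 0 < t → y₁ t * deriv y₂ t - deriv y₁ t * y₂ t = C := fun t ht =>
    wronskian_eqOn_const (convex_Ioi 0) h₁.differentiable h₂.differentiable
      (fun _ => h₁.hasDerivAt_deriv) (fun _ => h₂.hasDerivAt_deriv) hx ht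
  have hratio : Tendsto (fun t => (y₂ t / y₁ t / C).re) atTop (𝓝 (1 / C).re) :=
    (Complex.continuous_re.tendsto _).comp
      (((isEquivalent_iff_tendsto_one h₁.eventually_ne_zero).1
        (h₂.asymptotics.trans h₁.asymptotics.symm)).div_const C)
  refine not_tendsto_nhds_of_tendsto_deriv_atTop ?_ h₁.tendsto_re_inv_sq _ hratio
  filter_upwards [h₁.eventually_ne_zero, eventually_gt_atTop 0] with t hy ht
  have hquot := ((h₂.differentiable t ht).hasDerivAt.div (h₁.differentiable t ht).hasDerivAt
    hy).div_const C
  refine (Complex.reCLM.hasFDerivAt.comp_hasDerivAt t hquot).congr_deriv ?_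
  have : deriv y₂ t * y₁ t - y₂ t * deriv y₁ t = C := by rw [← hW t ht]; ring
  rw [this, Complex.reCLM_apply, div_right_comm, div_self hC, one_div]

theorem IsWhittakerW.eventuallyEq (h₁ : IsWhittakerW k μ y₁) (h₂ : IsWhittakerW k μ y₂) :
    y₁ =ᶠ[atTop] y₂ := by
  obtain ⟨T, hT⟩ := eventually_atTop.1 (h₁.eventually_ne_zero.and (eventually_gt_atTop 0))
  have hderiv : ∀ x ∈ Ici T, HasDerivWithinAt (fun x => y₂ x / y₁ x) 0 (Ici T) x := fun x hx => by
    obtain ⟨hy, hx0⟩ := hT x hx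
    refine (((h₂.differentiable x hx0).hasDerivAt.div (h₁.differentiable x hx0).hasDerivAt
      hy).congr_deriv ?_).hasDerivWithinAt
    rw [div_eq_zero_iff]
    left
    linear_combination h₁.wronskian_eq_zero h₂ hx0
  have hconst : ∀ x ≥ T, y₂ x / y₁ x = y₂ T / y₁ T := fun x hx => by
    simpa [sub_eq_zero] using (convex_Ici T).norm_image_sub_le_of_norm_hasDerivWithin_le (C := 0)
      hderiv (by simp) self_mem_Ici hx
  have hone : y₂ T / y₁ T = 1 := tendsto_nhds_unique
    (tendsto_const_nhds.congr' ((eventually_ge_atTop T).mono fun x hx => (hconst x hx).symm))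
    ((isEquivalent_iff_tendsto_one h₁.eventually_ne_zero).1
      (h₂.asymptotics.trans h₁.asymptotics.symm))
  filter_upwards [eventually_ge_atTop T] with x hx
  exact ((div_eq_one_iff_eq (hT x hx).1).1 ((hconst x hx).trans hone)).symm

theorem IsWhittakerW.eqOn (h₁ : IsWhittakerW k μ y₁) (h₂ : IsWhittakerW k μ y₂) :
    EqOn y₁ y₂ (Ioi 0) := fun x (hx : 0 < x) => by
  obtain ⟨T, hT⟩ := eventually_atTop.1 (h₁.eventuallyEq h₂)
  have hnhds : y₁ =ᶠ[𝓝 (max T x + 1)] y₂ :=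
    (eventually_gt_nhds ((le_max_left T x).trans_lt (lt_add_one _))).mono fun t ht => hT t ht.le
  have hpos : ∀ t ∈ Icc x (max T x + 1), 0 < t := fun t ht => hx.trans_le ht.1
  refine eqOn_Icc_of_deriv_deriv_eq_mul ?_ (fun t ht => h₁.differentiable t (hpos t ht))
    (fun t ht => h₂.differentiable t (hpos t ht)) (fun t ht => h₁.hasDerivAt_deriv (hpos t ht))
    (fun t ht => h₂.hasDerivAt_deriv (hpos t ht)) hnhds.eq_of_nhds hnhds.deriv_eq
    (left_mem_Icc.2 ((le_max_right T x).trans (le_add_of_nonneg_right zero_le_one)))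
  intro t ht
  have hne : (t : ℂ) ≠ 0 := Complex.ofReal_ne_zero.2 (hpos t ht).ne'
  fun_prop (disch := simp [hne])

theorem whittakerW_eq (hy : IsWhittakerW k μ y) {x : ℝ} (hx : 0 < x) : whittakerW k μ x = y x :=
  (Classical.epsilon_spec (p := IsWhittakerW k μ) ⟨y, hy⟩).eqOn hy hx

end Uniqueness

section TricomiIntegral

/-- The kernel of Tricomi's confluent hypergeometric function:
`Γ(p) U(p, b + 1, x) = ∫ e^{-xt} t^{p-1} (1+t)^{b-p} dt` over `(0, ∞)`. The index `b` is shifted by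
one against the usual one, so that `b` and `-b` play symmetric roles. -/
def tricomiKernel (p b : ℂ) (t : ℝ) : ℂ := (t : ℂ) ^ (p - 1) * ((1 + t : ℝ) : ℂ) ^ (b - p)

/-- The function `Γ(p) U(p, b + 1, x)`, as a Laplace integral; it converges for `0 < re p`. -/
def tricomiIntegral (p b : ℂ) (x : ℝ) : ℂ :=
  ∫ t in Ioi (0 : ℝ), (Real.exp (-(x * t)) : ℂ) * tricomiKernel p b t

variable {p b : ℂ} {x t : ℝ}

theorem hasDerivAt_ofReal_cpow_of_pos (c : ℂ) (ht : 0 < t) :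
    HasDerivAt (fun t : ℝ => (t : ℂ) ^ c) (c * (t : ℂ) ^ (c - 1)) t := by
  simpa using
    (HasDerivAt.cpow_const (c := c) (hasDerivAt_id (t : ℂ)) (by simpa using ht)).comp_ofReal

theorem hasDerivAt_one_add_cpow (c : ℂ) (ht : 0 ≤ t) :
    HasDerivAt (fun t : ℝ => ((1 + t : ℝ) : ℂ) ^ c) (c * ((1 + t : ℝ) : ℂ) ^ (c - 1)) t := by
  simpa [Function.comp_def] using
    (hasDerivAt_ofReal_cpow_of_pos c (by positivity : 0 < 1 + t)).scomp t
      ((hasDerivAt_id t).const_add 1)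

theorem continuousOn_one_add_cpow (c : ℂ) :
    ContinuousOn (fun t : ℝ => ((1 + t : ℝ) : ℂ) ^ c) (Ici 0) := fun _ ht =>
  (hasDerivAt_one_add_cpow c ht).continuousAt.continuousWithinAt

theorem continuousOn_ofReal_cpow (c : ℂ) : ContinuousOn (fun t : ℝ => (t : ℂ) ^ c) (Ioi 0) :=
  fun _ ht => (hasDerivAt_ofReal_cpow_of_pos c ht).continuousAt.continuousWithinAt

theorem continuousOn_tricomiKernel (p b : ℂ) : ContinuousOn (tricomiKernel p b) (Ioi 0) :=
  (continuousOn_ofReal_cpow _).mul ((continuousOn_one_add_cpow _).mono Ioi_subset_Ici_self)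

theorem norm_tricomiKernel (p b : ℂ) (ht : 0 < t) :
    ‖tricomiKernel p b t‖ = t ^ (p.re - 1) * (1 + t) ^ (b.re - p.re) := by
  rw [tricomiKernel, norm_mul, Complex.norm_cpow_eq_rpow_re_of_pos ht,
    Complex.norm_cpow_eq_rpow_re_of_pos (by positivity), Complex.sub_re, Complex.sub_re,
    Complex.one_re]

theorem norm_exp_mul_tricomiKernel (p b : ℂ) (x : ℝ) (ht : 0 < t) :
    ‖(Real.exp (-(x * t)) : ℂ) * tricomiKernel p b t‖
      = Real.exp (-(x * t)) * (t ^ (p.re - 1) * (1 + t) ^ (b.re - p.re)) := by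
  rw [norm_mul, norm_tricomiKernel p b ht, Complex.norm_real, Real.norm_eq_abs, Real.abs_exp]

theorem tricomiKernel_add_one_add_one (p b : ℂ) (ht : 0 < t) :
    tricomiKernel (p + 1) (b + 1) t = t * tricomiKernel p b t := by
  have ht' : (t : ℂ) ≠ 0 := Complex.ofReal_ne_zero.2 ht.ne'
  rw [tricomiKernel, tricomiKernel, add_sub_right_comm, Complex.cpow_add _ _ ht', Complex.cpow_one,
    add_sub_add_right_eq_sub]
  ring

theorem tricomiKernel_add_one_right (p b : ℂ) (ht : 0 < t) :
    tricomiKernel p (b + 1) t = tricomiKernel p b t + tricomiKernel (p + 1) (b + 1) t := by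
  have ht' : ((1 + t : ℝ) : ℂ) ≠ 0 := Complex.ofReal_ne_zero.2 (by positivity)
  rw [tricomiKernel_add_one_add_one p b ht, tricomiKernel, tricomiKernel, add_sub_right_comm,
    Complex.cpow_add _ _ ht', Complex.cpow_one]
  push_cast
  ring

theorem hasDerivAt_tricomiKernel (p b : ℂ) (ht : 0 < t) :
    HasDerivAt (tricomiKernel (p + 1) (b + 1))
      (p * tricomiKernel p b t + (b - p) * tricomiKernel (p + 1) b t) t := by
  have hfun : tricomiKernel (p + 1) (b + 1)
      = fun t : ℝ => (t : ℂ) ^ p * ((1 + t : ℝ) : ℂ) ^ (b - p) := funext fun s => by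
    rw [tricomiKernel, add_sub_cancel_right, add_sub_add_right_eq_sub]
  rw [hfun, tricomiKernel, tricomiKernel, add_sub_cancel_right, sub_add_eq_sub_sub]
  exact ((hasDerivAt_ofReal_cpow_of_pos p ht).mul
    (hasDerivAt_one_add_cpow (b - p) ht.le)).congr_deriv (by ring)

theorem isBigO_exp_mul_one_add_cpow (c : ℂ) (hx : 0 < x) :
    (fun t : ℝ => (Real.exp (-(x * t)) : ℂ) * ((1 + t : ℝ) : ℂ) ^ c)
      =O[atTop] fun t : ℝ => Real.exp (-(x / 2) * t) := by
  have hpow : (fun t : ℝ => ((1 + t : ℝ) : ℂ) ^ c) =O[atTop]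
      fun t : ℝ => Real.exp (x / 2 * (1 + t)) := by
    refine IsBigO.trans (IsBigO.of_norm_eventuallyLE ?_)
      ((isLittleO_rpow_exp_pos_mul_atTop c.re (half_pos hx)).isBigO.comp_tendsto
        (tendsto_atTop_add_const_left atTop 1 tendsto_id))
    filter_upwards [eventually_ge_atTop 0] with t ht
    exact (Complex.norm_cpow_eq_rpow_re_of_pos (by positivity) c).le
  refine ((Complex.isBigO_ofReal_left.2 (isBigO_refl (fun t => Real.exp (-(x * t))) atTop)).mul
    hpow).trans (IsBigO.of_bound (Real.exp (x / 2)) (Eventually.of_forall fun t => le_of_eq ?_))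
  rw [← Real.exp_add, Real.norm_eq_abs, Real.norm_eq_abs, Real.abs_exp, Real.abs_exp,
    ← Real.exp_add]
  ring_nf

theorem integrableOn_exp_mul_tricomiKernel (hp : 0 < p.re) (b : ℂ) (hx : 0 < x) :
    IntegrableOn (fun t => (Real.exp (-(x * t)) : ℂ) * tricomiKernel p b t) (Ioi 0) := by
  have hcont : ContinuousOn
      (fun t : ℝ => (Real.exp (-(x * t)) : ℂ) * ((1 + t : ℝ) : ℂ) ^ (b - p)) (Ici 0) :=
    (by fun_prop : Continuous fun t : ℝ => (Real.exp (-(x * t)) : ℂ)).continuousOn.mul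
      (continuousOn_one_add_cpow _)
  have hbot := (hcont 0 self_mem_Ici).mono_left (nhdsWithin_mono 0 Ioi_subset_Ici_self)
  refine IntegrableOn.congr_fun (mellinConvergent_of_isBigO_rpow_exp (half_pos hx)
    ((hcont.mono Ioi_subset_Ici_self).locallyIntegrableOn measurableSet_Ioi)
    (isBigO_exp_mul_one_add_cpow (b - p) hx) (b := 0) (by simpa using hbot.isBigO_one ℝ) hp)
    (fun t _ => ?_) measurableSet_Ioi
  simp only [smul_eq_mul, tricomiKernel]
  ring

theorem hasDerivAt_tricomiIntegral (hp : 0 < p.re) (b : ℂ) (hx : 0 < x) :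
    HasDerivAt (tricomiIntegral p b) (-tricomiIntegral (p + 1) (b + 1) x) x := by
  have hp' : 0 < (p + 1).re := by simpa using hp.trans (lt_add_one _)
  have hmeas : ∀ (p b : ℂ) (y : ℝ), AEStronglyMeasurable
      (fun t : ℝ => (Real.exp (-(y * t)) : ℂ) * tricomiKernel p b t) (volume.restrict (Ioi 0)) :=
    fun p b y => ((by fun_prop :
      Continuous fun t : ℝ => (Real.exp (-(y * t)) : ℂ)).continuousOn.mul
        (continuousOn_tricomiKernel p b)).aestronglyMeasurable measurableSet_Ioi
  rw [tricomiIntegral, ← integral_neg]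
  refine (hasDerivAt_integral_of_dominated_loc_of_deriv_le (Ioi_mem_nhds (half_lt_self hx))
    (Eventually.of_forall (hmeas p b))
    (integrableOn_exp_mul_tricomiKernel hp b hx)
    (F' := fun y t => -((Real.exp (-(y * t)) : ℂ) * tricomiKernel (p + 1) (b + 1) t))
    (hmeas (p + 1) (b + 1) x).neg (ae_restrict_of_forall_mem measurableSet_Ioi fun t ht y hy => ?_)
    (integrableOn_exp_mul_tricomiKernel hp' (b + 1) (half_pos hx)).norm
    (ae_restrict_of_forall_mem measurableSet_Ioi fun t ht y _ => ?_)).2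
  · rw [norm_neg, norm_exp_mul_tricomiKernel _ _ _ ht, norm_exp_mul_tricomiKernel _ _ _ ht]
    have ht0 : 0 < t := ht
    have hy' : x / 2 ≤ y := hy.le
    gcongr
  · have hexp : HasDerivAt (fun y : ℝ => Real.exp (-(y * t))) (Real.exp (-(y * t)) * (-t)) y := by
      simpa using ((hasDerivAt_id y).mul_const t).neg.exp
    refine (hexp.ofReal_comp.mul_const (tricomiKernel p b t)).congr_deriv ?_
    rw [tricomiKernel_add_one_add_one p b ht]
    push_cast
    ring

theorem tricomiIntegral_add_one_right (hp : 0 < p.re) (b : ℂ) (hx : 0 < x) :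
    tricomiIntegral p (b + 1) x = tricomiIntegral p b x + tricomiIntegral (p + 1) (b + 1) x := by
  have hp' : 0 < (p + 1).re := by simpa using hp.trans (lt_add_one _)
  rw [tricomiIntegral, tricomiIntegral, tricomiIntegral,
    ← integral_add (integrableOn_exp_mul_tricomiKernel hp b hx)
      (integrableOn_exp_mul_tricomiKernel hp' (b + 1) hx)]
  exact setIntegral_congr_fun measurableSet_Ioi fun t ht => by
    simp only [tricomiKernel_add_one_right p b ht, mul_add]

theorem mul_tricomiIntegral_add_one_add_one (hp : 0 < p.re) (b : ℂ) (hx : 0 < x) :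
    x * tricomiIntegral (p + 1) (b + 1) x
      = p * tricomiIntegral p b x + (b - p) * tricomiIntegral (p + 1) b x := by
  have hp' : 0 < (p + 1).re := by simpa using hp.trans (lt_add_one _)
  have hint := integrableOn_exp_mul_tricomiKernel hp' (b + 1) hx
  have hint₁ := (integrableOn_exp_mul_tricomiKernel hp b hx).const_mul p
  have hint₂ := (integrableOn_exp_mul_tricomiKernel hp' b hx).const_mul (b - p)
  have hderiv : ∀ t ∈ Ioi (0 : ℝ), HasDerivAt
      (fun t => (Real.exp (-(x * t)) : ℂ) * tricomiKernel (p + 1) (b + 1) t)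
      (p * ((Real.exp (-(x * t)) : ℂ) * tricomiKernel p b t)
        + (b - p) * ((Real.exp (-(x * t)) : ℂ) * tricomiKernel (p + 1) b t)
        - x * ((Real.exp (-(x * t)) : ℂ) * tricomiKernel (p + 1) (b + 1) t)) t := fun t ht => by
    have hexp : HasDerivAt (fun t : ℝ => Real.exp (-(x * t))) (Real.exp (-(x * t)) * (-x)) t := by
      simpa using ((hasDerivAt_id t).const_mul x).neg.exp
    refine (hexp.ofReal_comp.mul (hasDerivAt_tricomiKernel p b ht)).congr_deriv ?_
    push_cast
    ring
  have hcont : ContinuousWithinAt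
      (fun t => (Real.exp (-(x * t)) : ℂ) * tricomiKernel (p + 1) (b + 1) t) (Ici 0) 0 := by
    refine ContinuousWithinAt.mul (by fun_prop) (ContinuousWithinAt.mul
      (Complex.continuousAt_ofReal_cpow_const 0 _ (Or.inl ?_)).continuousWithinAt
      (continuousOn_one_add_cpow _ 0 self_mem_Ici))
    simpa using hp
  have hparts := integral_Ioi_of_hasDerivAt_of_tendsto hcont hderiv
    ((hint₁.add hint₂).sub (hint.const_mul (x : ℂ)))
    (tendsto_zero_of_hasDerivAt_of_integrableOn_Ioi hderiv
      ((hint₁.add hint₂).sub (hint.const_mul (x : ℂ))) hint)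
  have hzero : tricomiKernel (p + 1) (b + 1) 0 = 0 := by
    have : p ≠ 0 := fun h => by simp [h] at hp
    simp [tricomiKernel, this]
  rw [hzero, mul_zero, sub_zero] at hparts
  replace hparts := (integral_sub (hint₁.add hint₂) (hint.const_mul (x : ℂ))).symm.trans hparts
  rw [integral_add' hint₁ hint₂, integral_const_mul, integral_const_mul, integral_const_mul]
    at hparts
  exact (sub_eq_zero.1 hparts).symm

theorem cpow_mul_tricomiIntegral (p b : ℂ) (hx : 0 < x) :
    (x : ℂ) ^ p * tricomiIntegral p b x = ∫ s in Ioi (0 : ℝ),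
      (Real.exp (-s) : ℂ) * ((s : ℂ) ^ (p - 1) * ((1 + s / x : ℝ) : ℂ) ^ (b - p)) := by
  have hx0 : (x : ℂ) ≠ 0 := Complex.ofReal_ne_zero.2 hx.ne'
  have hscale := integral_comp_mul_left_Ioi (fun s : ℝ => (Real.exp (-s) : ℂ) *
    ((s : ℂ) ^ (p - 1) * ((1 + s / x : ℝ) : ℂ) ^ (b - p))) 0 hx
  rw [mul_zero, Complex.real_smul, Complex.ofReal_inv, eq_inv_mul_iff_mul_eq₀ hx0] at hscale
  rw [← hscale, tricomiIntegral, ← integral_const_mul, ← integral_const_mul]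
  refine setIntegral_congr_fun measurableSet_Ioi fun s hs => ?_
  rw [tricomiKernel, mul_div_cancel_left₀ _ hx.ne', Complex.ofReal_mul x s,
    Complex.mul_cpow_ofReal_nonneg hx.le (le_of_lt hs), Complex.cpow_sub _ _ hx0, Complex.cpow_one]
  field_simp

theorem one_add_div_rpow_le (r : ℝ) (ht : 0 ≤ t) (hx : 1 ≤ x) :
    (1 + t / x) ^ r ≤ (1 + t) ^ |r| := by
  have hdiv : 0 ≤ t / x := by positivity
  calc (1 + t / x) ^ r ≤ (1 + t / x) ^ |r| :=
        Real.rpow_le_rpow_of_exponent_le (le_add_of_nonneg_right hdiv) (le_abs_self r)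
    _ ≤ (1 + t) ^ |r| := by
        gcongr
        exact div_le_self ht hx

theorem tendsto_cpow_mul_tricomiIntegral (hp : 0 < p.re) (b : ℂ) :
    Tendsto (fun x : ℝ => (x : ℂ) ^ p * tricomiIntegral p b x) atTop (𝓝 (Complex.Gamma p)) := by
  refine Tendsto.congr' (f₁ := fun x : ℝ => ∫ s in Ioi (0 : ℝ), (Real.exp (-s) : ℂ) *
      ((s : ℂ) ^ (p - 1) * ((1 + s / x : ℝ) : ℂ) ^ (b - p)))
    ((eventually_gt_atTop 0).mono fun x hx => (cpow_mul_tricomiIntegral p b hx).symm) ?_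
  rw [Complex.Gamma_eq_integral hp, Complex.GammaIntegral]
  refine tendsto_integral_filter_of_dominated_convergence
    (fun s => ‖(Real.exp (-(1 * s)) : ℂ) * tricomiKernel p (p + |(b - p).re|) s‖) ?_ ?_
    (integrableOn_exp_mul_tricomiKernel hp _ one_pos).norm ?_
  · filter_upwards [eventually_gt_atTop 0] with x hx
    have hdiv : ContinuousOn (fun s : ℝ => ((1 + s / x : ℝ) : ℂ) ^ (b - p)) (Ioi 0) :=
      (continuousOn_one_add_cpow (b - p)).comp (by fun_prop) fun s hs => (div_pos hs hx).le
    exact ((by fun_prop : Continuous fun s : ℝ => (Real.exp (-s) : ℂ)).continuousOn.mul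
      ((continuousOn_ofReal_cpow (p - 1)).mul hdiv)).aestronglyMeasurable measurableSet_Ioi
  · filter_upwards [eventually_ge_atTop 1] with x hx
    refine ae_restrict_of_forall_mem measurableSet_Ioi fun s (hs : 0 < s) => ?_
    rw [norm_exp_mul_tricomiKernel _ _ _ hs, norm_mul, norm_mul, Complex.norm_real,
      Real.norm_eq_abs, Real.abs_exp, one_mul, Complex.norm_cpow_eq_rpow_re_of_pos hs,
      Complex.norm_cpow_eq_rpow_re_of_pos (by positivity), Complex.add_re, Complex.ofReal_re,
      add_sub_cancel_left, Complex.sub_re, Complex.one_re]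
    gcongr
    exact one_add_div_rpow_le _ hs.le hx
  · refine ae_of_all _ fun s => ?_
    have hdiv : Tendsto (fun x : ℝ => 1 + s / x) atTop (𝓝 1) := by
      simpa using (tendsto_const_nhds.div_atTop tendsto_id).const_add (1 : ℝ)
    have hpow := (Complex.continuousAt_ofReal_cpow_const 1 (b - p)
      (Or.inr one_ne_zero)).tendsto.comp hdiv
    simpa [Function.comp_def] using (hpow.const_mul ((s : ℂ) ^ (p - 1))).const_mul
      (Real.exp (-s) : ℂ)

end TricomiIntegral

section BetaIntegral

variable {p b : ℂ} {t : ℝ}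

theorem ofReal_inv_cpow {r : ℝ} (hr : 0 ≤ r) (c : ℂ) : ((r⁻¹ : ℝ) : ℂ) ^ c = (r : ℂ) ^ (-c) := by
  rw [Complex.ofReal_inv, Complex.inv_cpow _ _
    (by simpa [Complex.arg_ofReal_of_nonneg hr] using Real.pi_pos.ne), Complex.cpow_neg]

theorem div_one_add_cpow (ht : 0 ≤ t) (c : ℂ) :
    ((t / (1 + t) : ℝ) : ℂ) ^ c = (t : ℂ) ^ c * ((1 + t : ℝ) : ℂ) ^ (-c) := by
  rw [div_eq_mul_inv, Complex.ofReal_mul, Complex.mul_cpow_ofReal_nonneg ht (by positivity),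
    ofReal_inv_cpow (by positivity)]

theorem one_sub_div_one_add (ht : 0 ≤ t) : 1 - t / (1 + t) = (1 + t)⁻¹ := by
  have : 1 + t ≠ 0 := by positivity
  field_simp
  ring

theorem image_div_one_add_Ioi : (fun t : ℝ => t / (1 + t)) '' Ioi 0 = Ioo 0 1 := by
  ext r
  constructor
  · rintro ⟨t, ht : 0 < t, rfl⟩
    exact ⟨by positivity, (div_lt_one (by positivity)).2 (by linarith)⟩
  · rintro ⟨h0, h1⟩
    have hr : 0 < 1 - r := by linarith
    refine ⟨r / (1 - r), div_pos h0 hr, ?_⟩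
    field_simp
    ring

theorem integral_tricomiKernel (u v : ℂ) :
    ∫ t in Ioi (0 : ℝ), tricomiKernel u (-v) t = Complex.betaIntegral u v := by
  have hinj : InjOn (fun t : ℝ => t / (1 + t)) (Ioi 0) := fun s hs t ht hst => by
    have hs' : (1 + s : ℝ) ≠ 0 := by have : (0 : ℝ) < s := hs; positivity
    have ht' : (1 + t : ℝ) ≠ 0 := by have : (0 : ℝ) < t := ht; positivity
    rw [div_eq_div_iff hs' ht'] at hst
    linarith
  have hderiv : ∀ t ∈ Ioi (0 : ℝ),
      HasDerivWithinAt (fun t : ℝ => t / (1 + t)) (1 / (1 + t) ^ 2) (Ioi 0) t := fun t ht => by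
    have ht' : (1 + t : ℝ) ≠ 0 := by have : (0 : ℝ) < t := ht; positivity
    exact (((hasDerivAt_id t).div ((hasDerivAt_id t).const_add 1) ht').congr_deriv
      (by simp)).hasDerivWithinAt
  rw [Complex.betaIntegral, intervalIntegral.integral_of_le zero_le_one,
    integral_Ioc_eq_integral_Ioo, ← image_div_one_add_Ioi,
    integral_image_eq_integral_abs_deriv_smul measurableSet_Ioi hderiv hinj]
  refine setIntegral_congr_fun measurableSet_Ioi fun t (ht : 0 < t) => ?_
  have h0 : ((1 + t : ℝ) : ℂ) ≠ 0 := Complex.ofReal_ne_zero.2 (by positivity)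
  have hsub : (1 : ℂ) - ((t / (1 + t) : ℝ) : ℂ) = (((1 + t)⁻¹ : ℝ) : ℂ) := by
    rw [← one_sub_div_one_add ht.le]
    push_cast
    rfl
  have hsq : ((1 / (1 + t) ^ 2 : ℝ) : ℂ) = ((1 + t : ℝ) : ℂ) ^ (-2 : ℂ) := by
    rw [Complex.cpow_neg, Complex.cpow_ofNat]
    push_cast
    rw [one_div]
  rw [abs_of_pos (by positivity), hsub, div_one_add_cpow ht.le, ofReal_inv_cpow (by positivity),
    Complex.real_smul, hsq, tricomiKernel,
    show -v - u = -2 + (-(u - 1) + -(v - 1)) by ring, Complex.cpow_add _ _ h0,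
    Complex.cpow_add _ _ h0]
  ring

theorem integrableOn_one_add_rpow {s : ℝ} (hs : s < -1) :
    IntegrableOn (fun t : ℝ => (1 + t) ^ s) (Ioi 0) := by
  simpa [add_comm] using integrableOn_add_rpow_Ioi_of_lt (c := 0) (m := 1) hs (by norm_num)

theorem norm_cpow_sub_one_le {c : ℂ} (hc : 1 ≤ c.re) {r : ℝ} (h0 : 0 < r) (h1 : r ≤ 1) :
    ‖(r : ℂ) ^ c - 1‖ ≤ ‖c‖ * (1 - r) := by
  have hbound : ∀ t ∈ Icc r 1, ‖c * (t : ℂ) ^ (c - 1)‖ ≤ ‖c‖ := fun t ht => by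
    rw [norm_mul, Complex.norm_cpow_eq_rpow_re_of_pos (h0.trans_le ht.1)]
    exact mul_le_of_le_one_right (norm_nonneg _)
      (Real.rpow_le_one (h0.trans_le ht.1).le ht.2 (by simpa using hc))
  simpa [abs_of_nonpos (sub_nonpos.2 h1)] using
    (convex_Icc r 1).norm_image_sub_le_of_norm_hasDerivWithin_le
      (fun t ht => (hasDerivAt_ofReal_cpow_of_pos c (h0.trans_le ht.1)).hasDerivWithinAt)
      hbound (right_mem_Icc.2 h1) (left_mem_Icc.2 h1)

theorem tricomiKernel_one (b : ℂ) :
    tricomiKernel 1 b = fun t : ℝ => ((1 + t : ℝ) : ℂ) ^ (b - 1) := by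
  ext t
  rw [tricomiKernel, sub_self, Complex.cpow_zero, one_mul]

theorem norm_tricomiKernel_sub_one_le (hp : 2 ≤ p.re) (b : ℂ) (ht : 0 < t) :
    ‖tricomiKernel p b t - tricomiKernel 1 b t‖ ≤ ‖p - 1‖ * (1 + t) ^ (b.re - 2) := by
  have h0 : ((1 + t : ℝ) : ℂ) ≠ 0 := Complex.ofReal_ne_zero.2 (by positivity)
  have hfactor : tricomiKernel p b t - tricomiKernel 1 b t
      = ((1 + t : ℝ) : ℂ) ^ (b - 1) * (((t / (1 + t) : ℝ) : ℂ) ^ (p - 1) - 1) := by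
    rw [tricomiKernel, tricomiKernel_one, div_one_add_cpow ht.le,
      show b - p = (b - 1) + -(p - 1) by ring, Complex.cpow_add _ _ h0]
    ring
  have hpow := norm_cpow_sub_one_le (c := p - 1) (r := t / (1 + t))
    (by rw [Complex.sub_re, Complex.one_re]; linarith) (by positivity)
    (div_le_one_of_le₀ (by linarith) (by positivity))
  calc ‖tricomiKernel p b t - tricomiKernel 1 b t‖
      = (1 + t) ^ (b.re - 1) * ‖((t / (1 + t) : ℝ) : ℂ) ^ (p - 1) - 1‖ := by
        rw [hfactor, norm_mul, Complex.norm_cpow_eq_rpow_re_of_pos (by positivity), Complex.sub_re,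
          Complex.one_re]
    _ ≤ (1 + t) ^ (b.re - 1) * (‖p - 1‖ * (1 - t / (1 + t))) := by gcongr
    _ = ‖p - 1‖ * ((1 + t) ^ (b.re - 1 - 1)) := by
        rw [one_sub_div_one_add ht.le, Real.rpow_sub_one (by positivity) (b.re - 1)]
        ring
    _ = ‖p - 1‖ * (1 + t) ^ (b.re - 2) := by norm_num [sub_sub]

theorem continuousOn_tricomiKernel_sub_one (p b : ℂ) :
    ContinuousOn (fun t => tricomiKernel p b t - tricomiKernel 1 b t) (Ioi 0) :=
  (continuousOn_tricomiKernel p b).sub (continuousOn_tricomiKernel 1 b)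

theorem integrableOn_tricomiKernel_sub_one (hp : 2 ≤ p.re) (hb : b.re < 1) :
    IntegrableOn (fun t => tricomiKernel p b t - tricomiKernel 1 b t) (Ioi 0) :=
  ((integrableOn_one_add_rpow (by linarith)).const_mul _).mono'
    ((continuousOn_tricomiKernel_sub_one p b).aestronglyMeasurable measurableSet_Ioi)
    (ae_restrict_of_forall_mem measurableSet_Ioi fun _ ht => norm_tricomiKernel_sub_one_le hp b ht)

theorem integrableOn_tricomiKernel (hp : 1 ≤ p.re) (hb : b.re < 0) :
    IntegrableOn (tricomiKernel p b) (Ioi 0) :=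
  (integrableOn_one_add_rpow (s := b.re - 1) (by linarith)).mono'
    ((continuousOn_tricomiKernel p b).aestronglyMeasurable measurableSet_Ioi)
    (ae_restrict_of_forall_mem measurableSet_Ioi fun t (ht : 0 < t) => by
      rw [norm_tricomiKernel p b ht]
      calc t ^ (p.re - 1) * (1 + t) ^ (b.re - p.re)
          ≤ (1 + t) ^ (p.re - 1) * (1 + t) ^ (b.re - p.re) := by
            gcongr
            linarith
        _ = (1 + t) ^ (b.re - 1) := by
            rw [← Real.rpow_add (by positivity)]
            ring_nf)

theorem tendsto_tricomiKernel_sub_one_atTop (hp : 2 ≤ p.re) (hb : b.re < 2) :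
    Tendsto (fun t => tricomiKernel p b t - tricomiKernel 1 b t) atTop (𝓝 0) := by
  have hdecay : Tendsto (fun t : ℝ => ‖p - 1‖ * (1 + t) ^ (b.re - 2)) atTop (𝓝 0) := by
    simpa [Function.comp_def] using (((tendsto_rpow_neg_atTop (y := 2 - b.re) (by linarith)).comp
      (tendsto_atTop_add_const_left atTop (1 : ℝ) tendsto_id)).const_mul ‖p - 1‖)
  exact squeeze_zero_norm' ((eventually_gt_atTop 0).mono fun _ ht =>
    norm_tricomiKernel_sub_one_le hp b ht) hdecay

theorem hasDerivAt_tricomiKernel_sub_one (p b : ℂ) (ht : 0 < t) :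
    HasDerivAt (fun t => tricomiKernel p (b + 1) t - tricomiKernel 1 (b + 1) t)
      (b * (tricomiKernel p b t - tricomiKernel 1 b t)
        + (p - 1) * tricomiKernel (p - 1) (b - 1) t) t := by
  have hone : HasDerivAt (tricomiKernel 1 (b + 1)) (b * tricomiKernel 1 b t) t := by
    rw [tricomiKernel_one, tricomiKernel_one, add_sub_cancel_right]
    exact hasDerivAt_one_add_cpow b ht.le
  have hsplit := tricomiKernel_add_one_right (p - 1) (b - 1) ht
  have hker := hasDerivAt_tricomiKernel (p - 1) b ht
  rw [sub_add_cancel, sub_add_cancel] at hsplit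
  rw [sub_add_cancel] at hker
  refine (hker.sub hone).congr_deriv ?_
  linear_combination (p - 1) * hsplit

theorem mul_integral_tricomiKernel_sub_one (hp : 2 ≤ p.re) (hb : b.re < 1) :
    b * ∫ t in Ioi (0 : ℝ), (tricomiKernel p b t - tricomiKernel 1 b t)
      = 1 - Complex.Gamma p * Complex.Gamma (1 - b) * (Complex.Gamma (p - b))⁻¹ := by
  have hp1 : 1 ≤ (p - 1).re := by rw [Complex.sub_re, Complex.one_re]; linarith
  have hp0 : p - 1 ≠ 0 := fun h => by norm_num [h] at hp1
  have hint₁ := (integrableOn_tricomiKernel_sub_one hp hb).const_mul b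
  have hint₂ := (integrableOn_tricomiKernel (b := b - 1) hp1 (by simpa using hb)).const_mul (p - 1)
  have hcont : ContinuousWithinAt
      (fun t => tricomiKernel p (b + 1) t - tricomiKernel 1 (b + 1) t) (Ici 0) 0 := by
    refine ContinuousWithinAt.sub (ContinuousWithinAt.mul
      (Complex.continuousAt_ofReal_cpow_const 0 _ (Or.inl (by linarith))).continuousWithinAt
      (continuousOn_one_add_cpow _ 0 self_mem_Ici)) ?_
    rw [tricomiKernel_one]
    exact continuousOn_one_add_cpow _ 0 self_mem_Ici
  have hparts := integral_Ioi_of_hasDerivAt_of_tendsto hcont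
    (fun t ht => hasDerivAt_tricomiKernel_sub_one p b ht) (hint₁.add hint₂)
    (tendsto_tricomiKernel_sub_one_atTop hp (by simpa using (by linarith : b.re + 1 < 2)))
  replace hparts := (integral_add hint₁ hint₂).symm.trans hparts
  have hbeta := integral_tricomiKernel (p - 1) (1 - b)
  rw [neg_sub, Complex.betaIntegral_eq_Gamma_mul_div _ _ (by linarith) (by simpa using hb),
    sub_add_sub_cancel] at hbeta
  have hzero : tricomiKernel p (b + 1) 0 - tricomiKernel 1 (b + 1) 0 = -1 := by
    simp [tricomiKernel, hp0]
  have hGamma := Complex.Gamma_add_one (p - 1) hp0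
  rw [sub_add_cancel] at hGamma
  rw [integral_const_mul, integral_const_mul, hbeta, hzero] at hparts
  rw [hGamma]
  linear_combination hparts

theorem continuousAt_integral_tricomiKernel_sub_one (hp : 2 ≤ p.re) (hb : b.re < 1) :
    ContinuousAt (fun b : ℂ => ∫ t in Ioi (0 : ℝ), (tricomiKernel p b t - tricomiKernel 1 b t))
      b := by
  obtain ⟨r, hbr, hr⟩ := exists_between hb
  refine continuousAt_of_dominated (bound := fun t => ‖p - 1‖ * (1 + t) ^ (r - 2))
    (Eventually.of_forall fun b =>
      (continuousOn_tricomiKernel_sub_one p b).aestronglyMeasurable measurableSet_Ioi) ?_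
    ((integrableOn_one_add_rpow (by linarith)).const_mul _)
    (ae_restrict_of_forall_mem measurableSet_Ioi fun t (ht : 0 < t) => ?_)
  · filter_upwards [(Complex.continuous_re.tendsto b).eventually (gt_mem_nhds hbr)] with c hc
    refine ae_restrict_of_forall_mem measurableSet_Ioi fun t (ht : 0 < t) => ?_
    refine (norm_tricomiKernel_sub_one_le hp c ht).trans ?_
    gcongr
    linarith
  · have h0 : 0 < ((1 + t : ℝ) : ℂ).re := by rw [Complex.ofReal_re]; positivity
    unfold tricomiKernel
    fun_prop (disch := exact Or.inl h0)

/-- The quotient `Γ(p) Γ(1 - b) / Γ(p - b)`, the ratio of the two Frobenius coefficients of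
`tricomiIntegral p b` at `0`; it is normalized to be `1` at `b = 0`. -/
def gammaQuot (p b : ℂ) : ℂ := Complex.Gamma p * Complex.Gamma (1 - b) * (Complex.Gamma (p - b))⁻¹

theorem hasDerivAt_gammaQuot (hp : 0 < p.re) : HasDerivAt (gammaQuot p)
    (-(deriv Complex.Gamma 1 + Complex.Gamma p * deriv (fun s => (Complex.Gamma s)⁻¹) p)) 0 := by
  have hGamma : HasDerivAt (fun b : ℂ => Complex.Gamma (1 - b)) (-deriv Complex.Gamma 1) 0 := by
    have hdiff : DifferentiableAt ℂ Complex.Gamma (1 - 0) := by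
      rw [sub_zero]
      exact Complex.differentiableAt_Gamma_one
    simpa using hdiff.hasDerivAt.comp_const_sub (a := 1)
  have hinv : HasDerivAt (fun b : ℂ => (Complex.Gamma (p - b))⁻¹)
      (-deriv (fun s => (Complex.Gamma s)⁻¹) p) 0 := by
    simpa using (Complex.differentiable_one_div_Gamma (p - 0)).hasDerivAt.comp_const_sub
  refine ((hGamma.const_mul (Complex.Gamma p)).mul hinv).congr_deriv ?_
  simp only [sub_zero, Complex.Gamma_one]
  field_simp [Complex.Gamma_ne_zero_of_re_pos hp]
  ring

theorem integral_tricomiKernel_sub_one (hp : 2 ≤ p.re) (hb : b.re < 1) :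
    ∫ t in Ioi (0 : ℝ), (tricomiKernel p b t - tricomiKernel 1 b t)
      = -dslope (gammaQuot p) 0 b := by
  have hp0 : 0 < p.re := by linarith
  have hone : gammaQuot p 0 = 1 := by
    simp [gammaQuot, Complex.Gamma_ne_zero_of_re_pos hp0]
  have hne : ∀ c : ℂ, c.re < 1 → c ≠ 0 →
      ∫ t in Ioi (0 : ℝ), (tricomiKernel p c t - tricomiKernel 1 c t)
        = -dslope (gammaQuot p) 0 c := fun c hc hc0 => by
    rw [dslope_of_ne _ hc0, slope_def_field, hone, sub_zero, ← neg_div, eq_div_iff hc0, neg_sub,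
      mul_comm, mul_integral_tricomiKernel_sub_one hp hc, gammaQuot]
  rcases eq_or_ne b 0 with rfl | hb0
  · have hslope := (continuousAt_dslope_same.2
      (hasDerivAt_gammaQuot hp0).differentiableAt).tendsto.mono_left
        (nhdsWithin_le_nhds (s := {0}ᶜ))
    refine tendsto_nhds_unique ((continuousAt_integral_tricomiKernel_sub_one hp
      hb).tendsto.mono_left (nhdsWithin_le_nhds (s := {0}ᶜ))) (hslope.neg.congr' ?_)
    filter_upwards [self_mem_nhdsWithin, nhdsWithin_le_nhds
      ((Complex.continuous_re.tendsto (0 : ℂ)).eventually (gt_mem_nhds hb))] with c hc0 hc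
    exact (hne c hc hc0).symm
  · exact hne b hb hb0

end BetaIntegral

section SmallArgument

variable {p b μ : ℂ} {r s x : ℝ}

/-- The antiderivative of `s ^ (b - 1)` that vanishes at `s = 1`: a power for `b ≠ 0`, the logarithm
for `b = 0`. -/
def cpowPrimitive (b : ℂ) (s : ℝ) : ℂ := if b = 0 then (Real.log s : ℂ) else ((s : ℂ) ^ b - 1) / b

theorem hasDerivAt_cpowPrimitive (b : ℂ) (hs : 0 < s) :
    HasDerivAt (cpowPrimitive b) ((s : ℂ) ^ (b - 1)) s := by
  unfold cpowPrimitive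
  split_ifs with hb
  · refine (Real.hasDerivAt_log hs.ne').ofReal_comp.congr_deriv ?_
    rw [hb, zero_sub, Complex.cpow_neg_one, Complex.ofReal_inv]
  · refine (((hasDerivAt_ofReal_cpow_of_pos b hs).sub_const 1).div_const b).congr_deriv ?_
    rw [mul_div_cancel_left₀ _ hb]

theorem continuousOn_cpowPrimitive (b : ℂ) : ContinuousOn (cpowPrimitive b) (Ioi 0) :=
  fun _ hs => (hasDerivAt_cpowPrimitive b hs).continuousAt.continuousWithinAt

theorem isBigO_rpow_rpow_nhdsGT_zero {q : ℝ} (h : r ≤ q) :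
    (fun x : ℝ => x ^ q) =O[𝓝[>] 0] fun x : ℝ => x ^ r := by
  refine IsBigO.of_norm_eventuallyLE ?_
  filter_upwards [Ioo_mem_nhdsGT one_pos] with x hx
  rw [Real.norm_of_nonneg (Real.rpow_nonneg hx.1.le _)]
  exact Real.rpow_le_rpow_of_exponent_ge hx.1 hx.2.le h

theorem isBigO_ofReal_cpow_nhdsGT_zero (c : ℂ) :
    (fun x : ℝ => (x : ℂ) ^ c) =O[𝓝[>] 0] fun x : ℝ => x ^ c.re :=
  IsBigO.of_norm_eventuallyLE <| eventually_mem_nhdsWithin.mono fun _ hx =>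
    (Complex.norm_cpow_eq_rpow_re_of_pos hx c).le

theorem isBigO_mul_rpow_nhdsGT_zero {f g : ℝ → ℂ} {q : ℝ}
    (hf : f =O[𝓝[>] 0] fun x : ℝ => x ^ r) (hg : g =O[𝓝[>] 0] fun x : ℝ => x ^ q) :
    (fun x => f x * g x) =O[𝓝[>] 0] fun x : ℝ => x ^ (r + q) :=
  (hf.mul hg).congr' EventuallyEq.rfl <| eventually_mem_nhdsWithin.mono fun _ hx =>
    (Real.rpow_add hx r q).symm

theorem isBigO_exp_mul_sub_one (k : ℝ) :
    (fun x : ℝ => (Real.exp (k * x) : ℂ) - 1) =O[𝓝[>] 0] fun x : ℝ => x := by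
  have hderiv : HasDerivAt (fun x : ℝ => (Real.exp (k * x) : ℂ)) _ 0 :=
    (((hasDerivAt_id (0 : ℝ)).const_mul k).exp).ofReal_comp
  simpa using hderiv.isBigO_sub.mono nhdsWithin_le_nhds

theorem isBigO_exp_mul_nhdsGT_zero (k : ℝ) :
    (fun x : ℝ => (Real.exp (k * x) : ℂ)) =O[𝓝[>] 0] fun _ => (1 : ℝ) :=
  (((by fun_prop : Continuous fun x : ℝ => (Real.exp (k * x) : ℂ)).tendsto 0).mono_left
    nhdsWithin_le_nhds).isBigO_one ℝ

theorem isBigO_cpowPrimitive_nhdsGT_zero (hr : 0 < r) (hb : -b.re ≤ r) :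
    cpowPrimitive b =O[𝓝[>] 0] fun s => s ^ (-r) := by
  unfold cpowPrimitive
  split_ifs with h
  · exact Complex.isBigO_ofReal_left.2
      (isLittleO_log_rpow_nhdsGT_zero (neg_lt_zero.2 hr)).isBigO
  · simp only [div_eq_inv_mul]
    refine IsBigO.const_mul_left (IsBigO.sub ((isBigO_ofReal_cpow_nhdsGT_zero b).trans
      (isBigO_rpow_rpow_nhdsGT_zero (by linarith))) ?_) _
    simpa using (isBigO_ofReal_cpow_nhdsGT_zero 0).trans
      (isBigO_rpow_rpow_nhdsGT_zero (r := -r) (by simpa using hr.le))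

theorem isBigO_cpowPrimitive_atTop (hb : b.re ≤ 1) : cpowPrimitive b =O[atTop] fun s => s := by
  unfold cpowPrimitive
  split_ifs with h
  · exact Complex.isBigO_ofReal_left.2 Real.isLittleO_log_id_atTop.isBigO
  · simp only [div_eq_inv_mul]
    refine IsBigO.const_mul_left (IsBigO.sub (IsBigO.of_norm_eventuallyLE ?_)
      (isLittleO_const_id_atTop _).isBigO) _
    filter_upwards [eventually_ge_atTop 1] with s hs
    rw [Complex.norm_cpow_eq_rpow_re_of_pos (by positivity)]
    exact (Real.rpow_le_rpow_of_exponent_le hs hb).trans_eq (Real.rpow_one s)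

theorem isBigO_exp_neg_mul_cpowPrimitive (hb : b.re ≤ 1) :
    (fun s : ℝ => (Real.exp (-s) : ℂ) * cpowPrimitive b s)
      =O[atTop] fun s => Real.exp (-(1 / 2) * s) := by
  have hpoly : cpowPrimitive b =O[atTop] fun s : ℝ => Real.exp (1 / 2 * s) := by
    refine (isBigO_cpowPrimitive_atTop hb).trans ?_
    simpa using (isLittleO_rpow_exp_pos_mul_atTop 1 (b := 1 / 2) (by norm_num)).isBigO
  refine ((Complex.isBigO_ofReal_left.2
    (isBigO_refl (fun s => Real.exp (-s)) atTop)).mul hpoly).congr_right fun s => ?_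
  rw [← Real.exp_add]
  ring_nf

theorem continuousOn_exp_neg_mul_cpowPrimitive (b : ℂ) :
    ContinuousOn (fun s : ℝ => (Real.exp (-s) : ℂ) * cpowPrimitive b s) (Ioi 0) :=
  ContinuousOn.mul (by fun_prop) (continuousOn_cpowPrimitive b)

theorem isBigO_exp_neg_mul_cpowPrimitive_nhdsGT_zero (hb : -1 < b.re) (hb' : b.re < 1) :
    (fun s : ℝ => (Real.exp (-s) : ℂ) * cpowPrimitive b s)
      =O[𝓝[>] 0] fun s => s ^ (-((1 - b.re) / 2)) := by
  simpa using (isBigO_exp_mul_nhdsGT_zero (-1)).mul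
    (isBigO_cpowPrimitive_nhdsGT_zero (b := b) (r := (1 - b.re) / 2) (by linarith) (by linarith))

theorem integrableOn_exp_neg_mul_cpowPrimitive (hb : -1 < b.re) (hb' : b.re < 1) :
    IntegrableOn (fun s : ℝ => (Real.exp (-s) : ℂ) * cpowPrimitive b s) (Ioi 0) := by
  simpa [MellinConvergent] using mellinConvergent_of_isBigO_rpow_exp (s := 1) one_half_pos
    ((continuousOn_exp_neg_mul_cpowPrimitive b).locallyIntegrableOn measurableSet_Ioi)
    (isBigO_exp_neg_mul_cpowPrimitive hb'.le)
    (isBigO_exp_neg_mul_cpowPrimitive_nhdsGT_zero hb hb') (by rw [Complex.one_re]; linarith)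

theorem integral_exp_neg_mul_cpowPrimitive (hb : -1 < b.re) :
    ∫ s in Ioi (0 : ℝ), (Real.exp (-s) : ℂ) * cpowPrimitive b s
      = dslope Complex.Gamma 1 (1 + b) := by
  rcases eq_or_ne b 0 with rfl | h
  · have hGamma : HasDerivAt Complex.Gamma
        (∫ t in Ioi (0 : ℝ), (t : ℂ) ^ ((1 : ℂ) - 1) * (Real.log t * Real.exp (-t))) 1 :=
      (Complex.hasDerivAt_GammaIntegral (by simp)).congr_of_eventuallyEq
        (((Complex.continuous_re.tendsto 1).eventually (lt_mem_nhds one_pos)).mono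
          fun s hs => Complex.Gamma_eq_integral hs)
    rw [add_zero, dslope_same, hGamma.deriv]
    refine setIntegral_congr_fun measurableSet_Ioi fun t _ => ?_
    simp only [cpowPrimitive, if_true, sub_self, Complex.cpow_zero, one_mul, mul_comm]
  · have hint : ∀ c : ℂ, -1 < c.re →
        IntegrableOn (fun s : ℝ => (Real.exp (-s) : ℂ) * (s : ℂ) ^ c) (Ioi 0) := fun c hc => by
      simpa using Complex.GammaIntegral_convergent (s := c + 1) (by simpa using by linarith)
    have hval : ∀ c : ℂ, -1 < c.re →
        ∫ s in Ioi (0 : ℝ), (Real.exp (-s) : ℂ) * (s : ℂ) ^ c = Complex.Gamma (1 + c) :=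
      fun c hc => by
        rw [Complex.Gamma_eq_integral (by simpa using by linarith), Complex.GammaIntegral,
          add_sub_cancel_left]
    have hsub := integral_sub (hint b hb) (hint 0 (by simp))
    rw [hval b hb, hval 0 (by simp), add_zero] at hsub
    rw [dslope_of_ne _ (by simpa using h), slope_def_field, add_sub_cancel_left, ← hsub,
      ← integral_div]
    refine setIntegral_congr_fun measurableSet_Ioi fun t _ => ?_
    simp only [cpowPrimitive, if_neg h, Complex.cpow_zero]
    ring

theorem cpow_mul_tricomiIntegral_one_eq (b : ℂ) (hx : 0 < x) :
    (x : ℂ) ^ b * tricomiIntegral 1 b x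
      = (Real.exp x : ℂ) * ∫ s in Ioi x, (Real.exp (-s) : ℂ) * (s : ℂ) ^ (b - 1) := by
  have hx0 : (x : ℂ) ≠ 0 := Complex.ofReal_ne_zero.2 hx.ne'
  have hshift := (measurePreserving_add_left volume x).setIntegral_preimage_emb
    (measurableEmbedding_addLeft x) (fun s : ℝ => (Real.exp (-s) : ℂ) * (s : ℂ) ^ (b - 1)) (Ioi x)
  rw [preimage_const_add_Ioi, sub_self] at hshift
  have hscale := integral_comp_mul_left_Ioi'
    (fun s : ℝ => (Real.exp (-(x + s)) : ℂ) * ((x + s : ℝ) : ℂ) ^ (b - 1)) 0 hx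
  rw [mul_zero, hshift, Complex.real_smul] at hscale
  rw [← hscale, tricomiIntegral, tricomiKernel_one, ← integral_const_mul, ← integral_const_mul,
    ← integral_const_mul]
  refine setIntegral_congr_fun measurableSet_Ioi fun t (ht : 0 < t) => ?_
  have hexp : (Real.exp x : ℂ) * Real.exp (-(x + x * t)) = Real.exp (-(x * t)) := by
    rw [← Complex.ofReal_mul, ← Real.exp_add]
    ring_nf
  have hpow : (x : ℂ) * ((x + x * t : ℝ) : ℂ) ^ (b - 1)
      = (x : ℂ) ^ b * ((1 + t : ℝ) : ℂ) ^ (b - 1) := by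
    rw [show x + x * t = x * (1 + t) by ring, Complex.ofReal_mul,
      Complex.mul_cpow_ofReal_nonneg hx.le (by positivity), Complex.cpow_sub _ _ hx0,
      Complex.cpow_one]
    field_simp
  linear_combination (-(x : ℂ) * ((x + x * t : ℝ) : ℂ) ^ (b - 1)) * hexp
    - (Real.exp (-(x * t)) : ℂ) * hpow

theorem integral_Ioi_exp_neg_mul_cpow (hb : -1 < b.re) (hb' : b.re < 1) (hx : 0 < x) :
    ∫ s in Ioi x, (Real.exp (-s) : ℂ) * (s : ℂ) ^ (b - 1)
      = (∫ s in Ioi x, (Real.exp (-s) : ℂ) * cpowPrimitive b s)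
        - (Real.exp (-x) : ℂ) * cpowPrimitive b x := by
  have hIoi : Ioi x ⊆ Ioi 0 := Ioi_subset_Ioi hx.le
  have hint : IntegrableOn (fun s : ℝ => (Real.exp (-s) : ℂ) * (s : ℂ) ^ (b - 1)) (Ioi x) := by
    refine ((integrableOn_exp_neg_Ioi x).mul_const (x ^ (b.re - 1))).mono'
      (((by fun_prop : Continuous fun s : ℝ => (Real.exp (-s) : ℂ)).continuousOn.mul
        ((continuousOn_ofReal_cpow _).mono hIoi)).aestronglyMeasurable measurableSet_Ioi)
      (ae_restrict_of_forall_mem measurableSet_Ioi fun s (hs : x < s) => ?_)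
    rw [norm_mul, Complex.norm_real, Real.norm_eq_abs, Real.abs_exp,
      Complex.norm_cpow_eq_rpow_re_of_pos (hx.trans hs), Complex.sub_re, Complex.one_re]
    exact mul_le_mul_of_nonneg_left (Real.rpow_le_rpow_of_nonpos hx hs.le (by linarith))
      (Real.exp_pos _).le
  have hint' := (integrableOn_exp_neg_mul_cpowPrimitive hb hb').mono_set hIoi
  have hderiv : ∀ s ∈ Ici x, HasDerivAt (fun s => (Real.exp (-s) : ℂ) * cpowPrimitive b s)
      ((Real.exp (-s) : ℂ) * (s : ℂ) ^ (b - 1) - (Real.exp (-s) : ℂ) * cpowPrimitive b s) s :=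
    fun s (hs : x ≤ s) => by
      have hexp : HasDerivAt (fun s : ℝ => Real.exp (-s)) (-Real.exp (-s)) s := by
        simpa using (hasDerivAt_id s).neg.exp
      refine (hexp.ofReal_comp.mul (hasDerivAt_cpowPrimitive b (hx.trans_le hs))).congr_deriv ?_
      push_cast
      ring
  have hparts := integral_Ioi_of_hasDerivAt_of_tendsto' hderiv (hint.sub hint')
    (tendsto_zero_of_hasDerivAt_of_integrableOn_Ioi (fun s hs => hderiv s (Ioi_subset_Ici_self hs))
      (hint.sub hint') hint')
  replace hparts := (integral_sub hint hint').symm.trans hparts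
  linear_combination hparts

theorem cpow_mul_tricomiIntegral_one (hb : -1 < b.re) (hb' : b.re < 1) (hx : 0 < x) :
    (x : ℂ) ^ b * tricomiIntegral 1 b x
      = (Real.exp x : ℂ) * (dslope Complex.Gamma 1 (1 + b)
          - ∫ s in Ioc 0 x, (Real.exp (-s) : ℂ) * cpowPrimitive b s) - cpowPrimitive b x := by
  have hint := integrableOn_exp_neg_mul_cpowPrimitive hb hb'
  have hsplit := setIntegral_union (Ioc_disjoint_Ioi le_rfl) measurableSet_Ioi
    (hint.mono_set Ioc_subset_Ioi_self) (hint.mono_set (Ioi_subset_Ioi hx.le))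
  rw [Ioc_union_Ioi_eq_Ioi hx.le, integral_exp_neg_mul_cpowPrimitive hb] at hsplit
  have hexp : (Real.exp x : ℂ) * Real.exp (-x) = 1 := by
    rw [← Complex.ofReal_mul, ← Real.exp_add, add_neg_cancel, Real.exp_zero, Complex.ofReal_one]
  rw [cpow_mul_tricomiIntegral_one_eq b hx, integral_Ioi_exp_neg_mul_cpow hb hb' hx, hsplit]
  linear_combination (-cpowPrimitive b x) * hexp

theorem isBigO_setIntegral_Ioc_nhdsGT_zero {f : ℝ → ℂ} (hr : r < 1)
    (hf : f =O[𝓝[>] 0] fun s => s ^ (-r)) :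
    (fun x => ∫ s in Ioc 0 x, f s) =O[𝓝[>] 0] fun x => x ^ (1 - r) := by
  obtain ⟨C, hC⟩ := hf.bound
  obtain ⟨δ, hδ : 0 < δ, hbound⟩ := mem_nhdsGT_iff_exists_Ioo_subset.1 hC
  refine IsBigO.of_bound (C / (1 - r)) ?_
  filter_upwards [Ioo_mem_nhdsGT hδ] with x hx
  have hint : IntervalIntegrable (fun s : ℝ => C * s ^ (-r)) volume 0 x :=
    (intervalIntegral.intervalIntegrable_rpow' (by linarith)).const_mul C
  have hpow : ∫ s in Ioc 0 x, C * s ^ (-r) = C / (1 - r) * x ^ (1 - r) := by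
    rw [← intervalIntegral.integral_of_le hx.1.le, intervalIntegral.integral_const_mul,
      integral_rpow (Or.inl (by linarith)), Real.zero_rpow (by linarith)]
    ring_nf
  rw [Real.norm_of_nonneg (Real.rpow_nonneg hx.1.le _), ← hpow]
  refine norm_integral_le_of_norm_le
    ((intervalIntegrable_iff_integrableOn_Ioc_of_le hx.1.le).1 hint)
    (ae_restrict_of_forall_mem measurableSet_Ioc fun s hs => ?_)
  simpa [abs_of_nonneg (Real.rpow_nonneg hs.1.le _)] using hbound ⟨hs.1, hs.2.trans_lt hx.2⟩

theorem one_sub_exp_neg_le_rpow {y θ : ℝ} (hy : 0 < y) (h0 : 0 ≤ θ) (h1 : θ ≤ 1) :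
    1 - Real.exp (-y) ≤ y ^ θ := by
  rcases le_total y 1 with h | h
  · calc 1 - Real.exp (-y) ≤ y ^ (1 : ℝ) := by
          rw [Real.rpow_one]; linarith [Real.add_one_le_exp (-y)]
      _ ≤ y ^ θ := Real.rpow_le_rpow_of_exponent_ge hy h h1
  · calc 1 - Real.exp (-y) ≤ 1 := by linarith [Real.exp_pos (-y)]
      _ ≤ y ^ θ := Real.one_le_rpow h h0

theorem norm_exp_sub_one_mul_tricomiKernel_sub_one_le (hp : 2 ≤ p.re) (b : ℂ) {θ t : ℝ}
    (hx : 0 < x) (ht : 0 < t) (h0 : 0 ≤ θ) (h1 : θ ≤ 1) :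
    ‖((Real.exp (-(x * t)) - 1 : ℝ) : ℂ) * (tricomiKernel p b t - tricomiKernel 1 b t)‖
      ≤ x ^ θ * (‖p - 1‖ * (1 + t) ^ (θ + (b.re - 2))) := by
  have hxt : 0 < x * t := mul_pos hx ht
  have hexp : ‖((Real.exp (-(x * t)) - 1 : ℝ) : ℂ)‖ ≤ x ^ θ * (1 + t) ^ θ := by
    rw [Complex.norm_real, Real.norm_eq_abs, abs_sub_comm, abs_of_nonneg
      (sub_nonneg.2 (Real.exp_le_one_iff.2 (neg_nonpos.2 hxt.le)))]
    calc 1 - Real.exp (-(x * t)) ≤ (x * t) ^ θ := one_sub_exp_neg_le_rpow hxt h0 h1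
      _ = x ^ θ * t ^ θ := Real.mul_rpow hx.le ht.le
      _ ≤ x ^ θ * (1 + t) ^ θ := by
          gcongr
          linarith
  rw [norm_mul]
  calc _ ≤ (x ^ θ * (1 + t) ^ θ) * (‖p - 1‖ * (1 + t) ^ (b.re - 2)) :=
        mul_le_mul hexp (norm_tricomiKernel_sub_one_le hp b ht) (norm_nonneg _) (by positivity)
    _ = x ^ θ * (‖p - 1‖ * (1 + t) ^ (θ + (b.re - 2))) := by
        rw [Real.rpow_add (by positivity)]
        ring

theorem isBigO_tricomiIntegral_sub_one (hp : 2 ≤ p.re) (hb : -1 < b.re) (hb' : b.re < 1) :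
    (fun x => tricomiIntegral p b x - tricomiIntegral 1 b x + dslope (gammaQuot p) 0 b)
      =O[𝓝[>] 0] fun x : ℝ => x ^ ((1 - b.re) / 2) := by
  set θ : ℝ := (1 - b.re) / 2 with hθ
  refine IsBigO.of_bound (∫ t in Ioi (0 : ℝ), ‖p - 1‖ * (1 + t) ^ (θ + (b.re - 2))) ?_
  filter_upwards [self_mem_nhdsWithin] with x (hx : 0 < x)
  have hint₁ := integrableOn_exp_mul_tricomiKernel (p := p) (by linarith) b hx
  have hint₂ := integrableOn_exp_mul_tricomiKernel (p := 1) (by simp) b hx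
  have heq : tricomiIntegral p b x - tricomiIntegral 1 b x + dslope (gammaQuot p) 0 b
      = ∫ t in Ioi (0 : ℝ), ((Real.exp (-(x * t)) - 1 : ℝ) : ℂ)
          * (tricomiKernel p b t - tricomiKernel 1 b t) := by
    rw [← neg_neg (dslope _ _ _), ← integral_tricomiKernel_sub_one hp hb', ← sub_eq_add_neg,
      tricomiIntegral, tricomiIntegral, ← integral_sub hint₁ hint₂]
    refine (integral_sub (hint₁.sub hint₂) (integrableOn_tricomiKernel_sub_one hp hb')).symm.trans
      (setIntegral_congr_fun measurableSet_Ioi fun t _ => ?_)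
    simp only [Pi.sub_apply]
    push_cast
    ring
  rw [heq, Real.norm_of_nonneg (Real.rpow_nonneg hx.le _), mul_comm, ← integral_const_mul]
  exact norm_integral_le_of_norm_le
    (((integrableOn_one_add_rpow (by linarith)).const_mul _).const_mul _)
    (ae_restrict_of_forall_mem measurableSet_Ioi fun t ht =>
      norm_exp_sub_one_mul_tricomiKernel_sub_one_le hp b hx ht (by linarith) (by linarith))

theorem isBigO_cpow_mul_tricomiIntegral_one_sub (hb : -1 < b.re) (hb' : b.re < 1) :
    (fun x : ℝ => (x : ℂ) ^ b * tricomiIntegral 1 b x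
        - (dslope Complex.Gamma 1 (1 + b) - cpowPrimitive b x))
      =O[𝓝[>] 0] fun x : ℝ => x ^ ((1 + b.re) / 2) := by
  have hlinear : (fun x : ℝ => x) =O[𝓝[>] 0] fun x : ℝ => x ^ ((1 + b.re) / 2) := by
    simpa using isBigO_rpow_rpow_nhdsGT_zero (r := (1 + b.re) / 2) (q := 1) (by linarith)
  have hintegral := isBigO_setIntegral_Ioc_nhdsGT_zero (by linarith)
    (isBigO_exp_neg_mul_cpowPrimitive_nhdsGT_zero hb hb')
  rw [show 1 - (1 - b.re) / 2 = (1 + b.re) / 2 by ring] at hintegral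
  have hprod : (fun x : ℝ => (Real.exp (1 * x) : ℂ)
      * ∫ s in Ioc 0 x, (Real.exp (-s) : ℂ) * cpowPrimitive b s)
      =O[𝓝[>] 0] fun x : ℝ => x ^ ((1 + b.re) / 2) := by
    simpa using (isBigO_exp_mul_nhdsGT_zero 1).mul hintegral
  refine ((((isBigO_exp_mul_sub_one 1).trans hlinear).const_mul_left
    (dslope Complex.Gamma 1 (1 + b))).sub hprod).congr' ?_ EventuallyEq.rfl
  filter_upwards [self_mem_nhdsWithin] with x hx
  rw [cpow_mul_tricomiIntegral_one hb hb' hx, one_mul]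
  ring

theorem ofReal_cpow_eq_exp (c : ℂ) (hx : 0 < x) :
    (x : ℂ) ^ c = Complex.exp (c * Real.log x) := by
  rw [Complex.cpow_def_of_ne_zero (Complex.ofReal_ne_zero.2 hx.ne'), ← Complex.ofReal_log hx.le,
    mul_comm]

/-- `sinh (μ τ) / μ`, continued by its limit value `τ` to `μ = 0`. -/
def sinhDiv (μ τ : ℂ) : ℂ := if μ = 0 then τ else Complex.sinh (μ * τ) / μ

theorem cpow_neg_mul_cpowPrimitive (μ : ℂ) (hx : 0 < x) :
    (x : ℂ) ^ (-μ) * cpowPrimitive (2 * μ) x = sinhDiv μ (Real.log x) := by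
  rw [cpowPrimitive, sinhDiv]
  rcases eq_or_ne μ 0 with rfl | h
  · simp
  · have hexp : Complex.exp (-(μ * Real.log x)) * Complex.exp (2 * μ * Real.log x)
        = Complex.exp (μ * Real.log x) := by
      rw [← Complex.exp_add]
      ring_nf
    rw [if_neg (by simpa using h), if_neg h, ofReal_cpow_eq_exp _ hx, ofReal_cpow_eq_exp _ hx,
      Complex.sinh, neg_mul]
    linear_combination (2 * μ)⁻¹ * hexp

theorem isBigO_cpow_mul_tricomiIntegral (hp : 2 ≤ p.re) (hμ : |μ.re| < 1 / 2) :
    (fun x : ℝ => (x : ℂ) ^ μ * tricomiIntegral p (2 * μ) x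
        - (-dslope (gammaQuot p) 0 (2 * μ) * (x : ℂ) ^ μ
          + dslope Complex.Gamma 1 (1 + 2 * μ) * (x : ℂ) ^ (-μ) - sinhDiv μ (Real.log x)))
      =O[𝓝[>] 0] fun x : ℝ => x ^ (1 / 2 : ℝ) := by
  obtain ⟨hμ₁, hμ₂⟩ := abs_lt.1 hμ
  have hre : (2 * μ).re = 2 * μ.re := by simp
  have hrem := isBigO_mul_rpow_nhdsGT_zero (isBigO_ofReal_cpow_nhdsGT_zero μ)
    (isBigO_tricomiIntegral_sub_one (b := 2 * μ) hp (by linarith) (by linarith))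
  have hone := isBigO_mul_rpow_nhdsGT_zero (isBigO_ofReal_cpow_nhdsGT_zero (-μ))
    (isBigO_cpow_mul_tricomiIntegral_one_sub (b := 2 * μ) (by linarith) (by linarith))
  rw [show μ.re + (1 - (2 * μ).re) / 2 = 1 / 2 by rw [hre]; ring] at hrem
  rw [show (-μ).re + (1 + (2 * μ).re) / 2 = 1 / 2 by rw [hre, Complex.neg_re]; ring] at hone
  refine (hrem.add hone).congr' ?_ EventuallyEq.rfl
  filter_upwards [self_mem_nhdsWithin] with x (hx : 0 < x)
  have hpow : (x : ℂ) ^ (-μ) * (x : ℂ) ^ (2 * μ) = (x : ℂ) ^ μ := by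
    rw [← Complex.cpow_add _ _ (Complex.ofReal_ne_zero.2 hx.ne')]
    ring_nf
  rw [← cpow_neg_mul_cpowPrimitive μ hx]
  linear_combination tricomiIntegral 1 (2 * μ) x * hpow

end SmallArgument

section Coefficients

variable {a μ : ℂ} {g : ℂ → ℂ}

/-- The even part of `f`. -/
def evenPart (f : ℂ → ℂ) (s : ℂ) : ℂ := (f s + f (-s)) / 2

/-- The odd part of `f` divided by the argument, continued by `f'(0)` to the origin. -/
def symmSlope (f : ℂ → ℂ) (s : ℂ) : ℂ := if s = 0 then deriv f 0 else (f s - f (-s)) / (2 * s)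

theorem evenPart_sub_mul (a μ : ℂ) (g : ℂ → ℂ) :
    evenPart (fun s => (s - a) * g s) μ = μ ^ 2 * symmSlope g μ - a * evenPart g μ := by
  rw [evenPart, evenPart, symmSlope]
  split_ifs with h
  · simp only [h, neg_zero]
    ring
  · field_simp
    ring

theorem symmSlope_sub_mul (hg : DifferentiableAt ℂ g 0) (a μ : ℂ) :
    symmSlope (fun s => (s - a) * g s) μ = evenPart g μ - a * symmSlope g μ := by
  rw [symmSlope, evenPart, symmSlope]
  split_ifs with h
  · have hd := ((hasDerivAt_id (0 : ℂ)).sub_const a).mul hg.hasDerivAt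
    have he : deriv (fun s => (s - a) * g s) 0 = 1 * g 0 + (0 - a) * deriv g 0 := hd.deriv
    rw [he, h, neg_zero]
    ring
  · field_simp
    ring

/-- The meromorphic function `s ↦ Γ(1 + 2s) / Γ(s - a)`; its values at `±μ` are, up to `±2μ`, the
coefficients of `x ^ ∓μ` in the behaviour of `x ^ (-1/2) * W_{a+1/2,μ}(x)` at the origin. -/
def connectionGamma (a s : ℂ) : ℂ := Complex.Gamma (1 + 2 * s) * (Complex.Gamma (s - a))⁻¹

theorem connectionGamma_eq (a : ℂ) :
    connectionGamma a = fun s => (s - a) * connectionGamma (a - 1) s := by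
  funext s
  have h := Complex.one_div_Gamma_eq_self_mul_one_div_Gamma_add_one (s - a)
  rw [connectionGamma, connectionGamma, h, show s - (a - 1) = s - a + 1 by ring]
  ring

theorem hasDerivAt_connectionGamma (a : ℂ) :
    HasDerivAt (connectionGamma a) (2 * deriv Complex.Gamma 1 * (Complex.Gamma (-a))⁻¹
      + deriv (fun s => (Complex.Gamma s)⁻¹) (-a)) 0 := by
  have hone : HasDerivAt (fun s : ℂ => 1 + 2 * s) 2 0 := by
    simpa using ((hasDerivAt_id (0 : ℂ)).const_mul 2).const_add 1
  have hΓ : HasDerivAt Complex.Gamma (deriv Complex.Gamma 1) (1 + 2 * 0) := by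
    rw [mul_zero, add_zero]
    exact Complex.differentiableAt_Gamma_one.hasDerivAt
  have hinv : HasDerivAt (fun s => (Complex.Gamma (s - a))⁻¹)
      (deriv (fun s => (Complex.Gamma s)⁻¹) (-a)) 0 := by
    have := (Complex.differentiable_one_div_Gamma (0 - a)).hasDerivAt.comp_sub_const 0 a
    rwa [zero_sub] at this
  refine ((hΓ.comp 0 hone).mul hinv).congr_deriv ?_
  simp only [Function.comp_apply, zero_sub, mul_zero, add_zero, Complex.Gamma_one]
  ring

/-- The coefficient of `cosh (μ log x)` in the behaviour of `x ^ (-1/2) * W_{a+1/2,μ}(x)` at the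
origin. -/
def coefC (μ a : ℂ) : ℂ := symmSlope (connectionGamma a) μ

/-- The coefficient of `sinh (μ log x) / μ` in the behaviour of `x ^ (-1/2) * W_{a+1/2,μ}(x)` at the
origin. -/
def coefS (μ a : ℂ) : ℂ := -evenPart (connectionGamma a) μ

theorem coefC_eq (μ a : ℂ) : coefC μ a = -coefS μ (a - 1) - a * coefC μ (a - 1) := by
  rw [coefC, connectionGamma_eq,
    symmSlope_sub_mul (hasDerivAt_connectionGamma _).differentiableAt, coefS, coefC, neg_neg]

theorem coefS_eq (μ a : ℂ) : coefS μ a = -μ ^ 2 * coefC μ (a - 1) - a * coefS μ (a - 1) := by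
  rw [coefS, connectionGamma_eq, evenPart_sub_mul, coefC, coefS]
  ring

theorem sq_sub_sq_mul_coefC (μ a : ℂ) :
    (a ^ 2 - μ ^ 2) * coefC μ (a - 1) = coefS μ a - a * coefC μ a := by
  linear_combination a * coefC_eq μ a - coefS_eq μ a

theorem sq_sub_sq_mul_coefS (μ a : ℂ) :
    (a ^ 2 - μ ^ 2) * coefS μ (a - 1) = μ ^ 2 * coefC μ a - a * coefS μ a := by
  linear_combination a * coefS_eq μ a - μ ^ 2 * coefC_eq μ a

theorem coefC_add_one (μ a : ℂ) : coefC μ (a + 1)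
    = -(2 * a + 1) * coefC μ a - (a ^ 2 - μ ^ 2) * coefC μ (a - 1) := by
  have h := coefC_eq μ (a + 1)
  rw [add_sub_cancel_right] at h
  linear_combination h + sq_sub_sq_mul_coefC μ a

theorem coefS_add_one (μ a : ℂ) : coefS μ (a + 1)
    = -(2 * a + 1) * coefS μ a - (a ^ 2 - μ ^ 2) * coefS μ (a - 1) := by
  have h := coefS_eq μ (a + 1)
  rw [add_sub_cancel_right] at h
  linear_combination h + sq_sub_sq_mul_coefS μ a

/-- The leading part of `x ^ (-1/2) * W_{a+1/2,μ}(x)` at the origin. -/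
def zeroMain (μ a : ℂ) (x : ℝ) : ℂ :=
  coefC μ a * Complex.cosh (μ * Real.log x) + coefS μ a * sinhDiv μ (Real.log x)

theorem zeroMain_add_one (μ a : ℂ) (x : ℝ) : zeroMain μ (a + 1) x
    = -(2 * a + 1) * zeroMain μ a x - (a ^ 2 - μ ^ 2) * zeroMain μ (a - 1) x := by
  rw [zeroMain, zeroMain, zeroMain, coefC_add_one, coefS_add_one]
  ring

theorem inv_Gamma_mul_dslope (hp : 0 < (μ - a).re) {x : ℝ} (hx : 0 < x) :
    (Complex.Gamma (μ - a))⁻¹ * (-dslope (gammaQuot (μ - a)) 0 (2 * μ) * (x : ℂ) ^ μ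
      + dslope Complex.Gamma 1 (1 + 2 * μ) * (x : ℂ) ^ (-μ) - sinhDiv μ (Real.log x))
      = zeroMain μ a x := by
  have hΓ : Complex.Gamma (μ - a) ≠ 0 := Complex.Gamma_ne_zero_of_re_pos hp
  rcases eq_or_ne μ 0 with rfl | h
  · have hquot := (hasDerivAt_gammaQuot hp).deriv
    simp only [zero_sub] at hΓ hquot ⊢
    simp only [zeroMain, coefC, coefS, symmSlope, evenPart, sinhDiv, if_true, mul_zero, add_zero,
      dslope_same, hquot, neg_zero, Complex.cpow_zero, zero_mul, Complex.cosh_zero,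
      (hasDerivAt_connectionGamma a).deriv, connectionGamma, Complex.Gamma_one, zero_sub]
    field_simp
    ring
  · have h2 : 2 * μ ≠ 0 := mul_ne_zero two_ne_zero h
    rw [dslope_of_ne _ h2, dslope_of_ne _ (by simpa using h), slope_def_field, slope_def_field,
      zeroMain, coefC, coefS, symmSlope, if_neg h, evenPart, sinhDiv, if_neg h, gammaQuot,
      gammaQuot, connectionGamma, connectionGamma, ofReal_cpow_eq_exp _ hx,
      ofReal_cpow_eq_exp _ hx, Complex.cosh, Complex.sinh, Complex.Gamma_one,
      show μ - a - 2 * μ = -μ - a by ring, show (1 : ℂ) - 2 * μ = 1 + 2 * -μ by ring]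
    simp only [sub_zero, Complex.Gamma_one, add_sub_cancel_left, neg_mul]
    field_simp
    ring

end Coefficients

section WhittakerPair

variable {μ a p : ℂ} {A B : ℝ → ℂ} {x : ℝ}

theorem isLittleO_ofReal_cpow_nhdsGT_zero {c : ℂ} {r : ℝ} (h : r < c.re) :
    (fun x : ℝ => (x : ℂ) ^ c) =o[𝓝[>] 0] fun x : ℝ => x ^ r := by
  have hlim : Tendsto (fun x : ℝ => x ^ (c.re - r)) (𝓝[>] 0) (𝓝 0) := by
    have := (Real.continuousAt_rpow_const 0 (c.re - r) (Or.inr (by linarith))).tendsto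
    rw [Real.zero_rpow (by linarith)] at this
    exact this.mono_left nhdsWithin_le_nhds
  refine (isBigO_ofReal_cpow_nhdsGT_zero c).trans_isLittleO <|
    (((isLittleO_one_iff ℝ).2 hlim).mul_isBigO (isBigO_refl (fun x : ℝ => x ^ r) _)).congr' ?_
      (Eventually.of_forall fun x => one_mul _)
  filter_upwards [self_mem_nhdsWithin] with x hx
  rw [← Real.rpow_add hx, sub_add_cancel]

theorem isLittleO_cosh_log (hμ : |μ.re| < 1 / 2) :
    (fun x : ℝ => Complex.cosh (μ * Real.log x)) =o[𝓝[>] 0] fun x : ℝ => x ^ (-1 / 2 : ℝ) := by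
  obtain ⟨hμ₁, hμ₂⟩ := abs_lt.1 hμ
  refine (((isLittleO_ofReal_cpow_nhdsGT_zero (c := μ) (by linarith)).add
    (isLittleO_ofReal_cpow_nhdsGT_zero (c := -μ) (by rw [Complex.neg_re]; linarith))).const_mul_left
      (1 / 2)).congr' ?_ EventuallyEq.rfl
  filter_upwards [self_mem_nhdsWithin] with x hx
  rw [ofReal_cpow_eq_exp _ hx, ofReal_cpow_eq_exp _ hx, Complex.cosh, neg_mul]
  ring

theorem isLittleO_sinhDiv_log (hμ : |μ.re| < 1 / 2) :
    (fun x : ℝ => sinhDiv μ (Real.log x)) =o[𝓝[>] 0] fun x : ℝ => x ^ (-1 / 2 : ℝ) := by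
  obtain ⟨hμ₁, hμ₂⟩ := abs_lt.1 hμ
  rcases eq_or_ne μ 0 with rfl | h
  · simp only [sinhDiv, if_true]
    exact Complex.isLittleO_ofReal_left.2 (isLittleO_log_rpow_nhdsGT_zero (by norm_num))
  refine (((isLittleO_ofReal_cpow_nhdsGT_zero (c := μ) (by linarith)).sub
    (isLittleO_ofReal_cpow_nhdsGT_zero (c := -μ) (by rw [Complex.neg_re]; linarith))).const_mul_left
      (1 / 2 / μ)).congr' ?_ EventuallyEq.rfl
  filter_upwards [self_mem_nhdsWithin] with x hx
  rw [ofReal_cpow_eq_exp _ hx, ofReal_cpow_eq_exp _ hx, sinhDiv, if_neg h, Complex.sinh, neg_mul]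
  ring

theorem isLittleO_zeroMain (hμ : |μ.re| < 1 / 2) (a : ℂ) :
    zeroMain μ a =o[𝓝[>] 0] fun x : ℝ => x ^ (-1 / 2 : ℝ) :=
  ((isLittleO_cosh_log hμ).const_mul_left _).add ((isLittleO_sinhDiv_log hμ).const_mul_left _)

/-- The pair `A = x ^ (-1/2) * W_{a+1/2,μ}(x)`, `B = x ^ (-1/2) * W_{a-1/2,μ}(x)`, characterized by
its first-order system, its normalization at infinity and its behaviour at the origin. -/
structure WhittakerPair (μ a : ℂ) (A B : ℝ → ℂ) : Prop where
  hasDerivAt_fst : ∀ x : ℝ, 0 < x →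
    HasDerivAt A (((a - x / 2) * A x + (a ^ 2 - μ ^ 2) * B x) / x) x
  hasDerivAt_snd : ∀ x : ℝ, 0 < x → HasDerivAt B (((x / 2 - a) * B x - A x) / x) x
  tendsto_fst : Tendsto (fun x : ℝ => A x / ((x : ℂ) ^ a * Complex.exp (-(x : ℂ) / 2))) atTop (𝓝 1)
  tendsto_snd : Tendsto (fun x : ℝ => B x / ((x : ℂ) ^ (a - 1) * Complex.exp (-(x : ℂ) / 2)))
    atTop (𝓝 1)
  isBigO_fst : (fun x => A x - zeroMain μ a x) =O[𝓝[>] 0] fun x : ℝ => x ^ (1 / 2 : ℝ)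
  isBigO_snd : (fun x => B x - zeroMain μ (a - 1) x) =O[𝓝[>] 0] fun x : ℝ => x ^ (1 / 2 : ℝ)

theorem isLittleO_of_sub_zeroMain_isBigO (hμ : |μ.re| < 1 / 2)
    (h : (fun x => A x - zeroMain μ a x) =O[𝓝[>] 0] fun x : ℝ => x ^ (1 / 2 : ℝ)) :
    A =o[𝓝[>] 0] fun x : ℝ => x ^ (-1 / 2 : ℝ) := by
  have hpow : (fun x : ℝ => x ^ (1 / 2 : ℝ)) =o[𝓝[>] 0] fun x : ℝ => x ^ (-1 / 2 : ℝ) := by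
    refine (isLittleO_ofReal_cpow_nhdsGT_zero (c := (1 / 2 : ℝ)) (r := -1 / 2)
      (by rw [Complex.ofReal_re]; norm_num)).norm_left.congr' ?_ EventuallyEq.rfl
    filter_upwards [self_mem_nhdsWithin] with x hx
    rw [Complex.norm_cpow_eq_rpow_re_of_pos hx, Complex.ofReal_re]
  simpa using (h.trans_isLittleO hpow).add (isLittleO_zeroMain hμ a)

theorem WhittakerPair.tendsto_fst_add_one (h : WhittakerPair μ a A B) :
    Tendsto (fun x : ℝ => ((x - 2 * a - 1) * A x - (a ^ 2 - μ ^ 2) * B x)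
      / ((x : ℂ) ^ (a + 1) * Complex.exp (-(x : ℂ) / 2))) atTop (𝓝 1) := by
  have hinv : Tendsto (fun x : ℝ => (x : ℂ)⁻¹) atTop (𝓝 0) := by
    simpa [Function.comp_def] using
      (Complex.continuous_ofReal.tendsto 0).comp tendsto_inv_atTop_zero
  have hlim := ((((hinv.const_mul (2 * a + 1)).const_sub 1).mul h.tendsto_fst)).sub
    (((hinv.pow 2).const_mul (a ^ 2 - μ ^ 2)).mul h.tendsto_snd)
  rw [show (1 - (2 * a + 1) * 0) * 1 - (a ^ 2 - μ ^ 2) * 0 ^ 2 * 1 = (1 : ℂ) by ring] at hlim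
  refine hlim.congr' ?_
  filter_upwards [eventually_gt_atTop 0] with x hx
  have hx0 : (x : ℂ) ≠ 0 := Complex.ofReal_ne_zero.2 hx.ne'
  have hpow := left_ne_zero_of_mul (cpow_mul_exp_ne_zero a hx)
  rw [Complex.cpow_add _ _ hx0, Complex.cpow_sub _ _ hx0, Complex.cpow_one]
  field_simp
  ring

theorem WhittakerPair.isBigO_fst_add_one (h : WhittakerPair μ a A B) (hμ : |μ.re| < 1 / 2) :
    (fun x : ℝ => (x - 2 * a - 1) * A x - (a ^ 2 - μ ^ 2) * B x - zeroMain μ (a + 1) x)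
      =O[𝓝[>] 0] fun x : ℝ => x ^ (1 / 2 : ℝ) := by
  have hmul := isBigO_mul_rpow_nhdsGT_zero (isBigO_ofReal_cpow_nhdsGT_zero 1)
    (isLittleO_of_sub_zeroMain_isBigO hμ h.isBigO_fst).isBigO
  rw [show (1 : ℂ).re + -1 / 2 = 1 / 2 by norm_num] at hmul
  refine (hmul.add ((h.isBigO_fst.const_mul_left (-(2 * a + 1))).sub
    (h.isBigO_snd.const_mul_left (a ^ 2 - μ ^ 2)))).congr_left fun x => ?_
  rw [zeroMain_add_one, Complex.cpow_one]
  ring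

theorem WhittakerPair.add_one (h : WhittakerPair μ a A B) (hμ : |μ.re| < 1 / 2) :
    WhittakerPair μ (a + 1) (fun x => (x - 2 * a - 1) * A x - (a ^ 2 - μ ^ 2) * B x) A where
  hasDerivAt_fst x hx := by
    have hx0 : (x : ℂ) ≠ 0 := Complex.ofReal_ne_zero.2 hx.ne'
    have hlin : HasDerivAt (fun x : ℝ => (x : ℂ) - 2 * a - 1) 1 x := by
      simpa using (((hasDerivAt_id x).ofReal_comp).sub_const (2 * a)).sub_const 1
    refine ((hlin.mul (h.hasDerivAt_fst x hx)).sub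
      ((h.hasDerivAt_snd x hx).const_mul (a ^ 2 - μ ^ 2))).congr_deriv ?_
    field_simp
    ring
  hasDerivAt_snd x hx := (h.hasDerivAt_fst x hx).congr_deriv (by ring)
  tendsto_fst := h.tendsto_fst_add_one
  tendsto_snd := by simpa using h.tendsto_fst
  isBigO_fst := h.isBigO_fst_add_one hμ
  isBigO_snd := by simpa using h.isBigO_fst

/-- Tricomi's integral representation of `x ^ (-1/2) * W_{a+1/2,μ}(x)`, where `p = μ - a`. -/
def whittakerBase (μ p : ℂ) (x : ℝ) : ℂ :=
  (x : ℂ) ^ μ * Complex.exp (-(x : ℂ) / 2)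
    * ((Complex.Gamma p)⁻¹ * tricomiIntegral p (2 * μ) x)

theorem hasDerivAt_whittakerBase (hp : 0 < p.re) (μ : ℂ) (hx : 0 < x) :
    HasDerivAt (whittakerBase μ p) ((x : ℂ) ^ μ * Complex.exp (-(x : ℂ) / 2)
      * ((Complex.Gamma p)⁻¹ * ((μ - x / 2) * tricomiIntegral p (2 * μ) x
        - x * tricomiIntegral (p + 1) (2 * μ + 1) x)) / x) x := by
  have hx0 : (x : ℂ) ≠ 0 := Complex.ofReal_ne_zero.2 hx.ne'
  have hexp : HasDerivAt (fun x : ℝ => Complex.exp (-(x : ℂ) / 2))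
      (Complex.exp (-(x : ℂ) / 2) * (-1 / 2)) x := by
    simpa using (((hasDerivAt_id x).ofReal_comp.neg).div_const 2).cexp
  refine (((hasDerivAt_ofReal_cpow_of_pos μ hx).mul hexp).mul
    ((hasDerivAt_tricomiIntegral hp (2 * μ) hx).const_mul (Complex.Gamma p)⁻¹)).congr_deriv ?_
  rw [Pi.mul_apply, Complex.cpow_sub _ _ hx0, Complex.cpow_one]
  field_simp
  ring

theorem tendsto_whittakerBase_div (hp : 0 < (μ - a).re) :
    Tendsto (fun x : ℝ => whittakerBase μ (μ - a) x / ((x : ℂ) ^ a * Complex.exp (-(x : ℂ) / 2)))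
      atTop (𝓝 1) := by
  have hΓ := (tendsto_cpow_mul_tricomiIntegral hp (2 * μ)).const_mul (Complex.Gamma (μ - a))⁻¹
  rw [inv_mul_cancel₀ (Complex.Gamma_ne_zero_of_re_pos hp)] at hΓ
  refine hΓ.congr' ?_
  filter_upwards [eventually_gt_atTop 0] with x hx
  have hpow := left_ne_zero_of_mul (cpow_mul_exp_ne_zero a hx)
  rw [whittakerBase, Complex.cpow_sub _ _ (Complex.ofReal_ne_zero.2 hx.ne')]
  field_simp

theorem isBigO_whittakerBase (hp : 2 ≤ (μ - a).re) (hμ : |μ.re| < 1 / 2) :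
    (fun x => whittakerBase μ (μ - a) x - zeroMain μ a x)
      =O[𝓝[>] 0] fun x : ℝ => x ^ (1 / 2 : ℝ) := by
  have hmain := (isBigO_cpow_mul_tricomiIntegral hp hμ).const_mul_left (Complex.Gamma (μ - a))⁻¹
  have hexp := (isBigO_exp_mul_nhdsGT_zero (-1 / 2)).mul hmain
  have hrem := isBigO_mul_rpow_nhdsGT_zero (r := 1)
    (by simpa only [Real.rpow_one] using isBigO_exp_mul_sub_one (-1 / 2))
    (isLittleO_zeroMain hμ a).isBigO
  rw [show (1 : ℝ) + -1 / 2 = 1 / 2 by norm_num] at hrem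
  simp only [one_mul] at hexp
  refine (hexp.add hrem).congr' ?_ EventuallyEq.rfl
  filter_upwards [self_mem_nhdsWithin] with x hx
  rw [← inv_Gamma_mul_dslope (by linarith) hx, whittakerBase, Complex.ofReal_exp,
    show ((-1 / 2 * x : ℝ) : ℂ) = -(x : ℂ) / 2 by push_cast; ring]
  ring

theorem whittakerPair_whittakerBase (hp : 2 ≤ (μ - a).re) (hμ : |μ.re| < 1 / 2) :
    WhittakerPair μ a (whittakerBase μ (μ - a)) (whittakerBase μ (μ - (a - 1))) := by
  have hp₀ : 0 < (μ - a).re := by linarith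
  have hre : (μ - (a - 1)).re = (μ - a).re + 1 := by simp; ring
  have hp₁ : 0 < (μ - (a - 1)).re := by linarith
  have hΓ := Complex.one_div_Gamma_eq_self_mul_one_div_Gamma_add_one (μ - a)
  rw [show μ - a + 1 = μ - (a - 1) by ring] at hΓ
  have hrec : ∀ x : ℝ, 0 < x → _ := fun x hx =>
    mul_tricomiIntegral_add_one_add_one hp₀ (2 * μ) hx
  rw [show μ - a + 1 = μ - (a - 1) by ring] at hrec
  refine ⟨fun x hx => ?_, fun x hx => ?_, tendsto_whittakerBase_div hp₀,
    tendsto_whittakerBase_div hp₁, isBigO_whittakerBase hp hμ,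
    isBigO_whittakerBase (by linarith) hμ⟩
  · refine (hasDerivAt_whittakerBase hp₀ μ hx).congr_deriv ?_
    congr 1
    rw [show μ - a + 1 = μ - (a - 1) by ring, whittakerBase, whittakerBase]
    linear_combination (-(x : ℂ) ^ μ * Complex.exp (-(x : ℂ) / 2) * (Complex.Gamma (μ - a))⁻¹)
      * hrec x hx - (x : ℂ) ^ μ * Complex.exp (-(x : ℂ) / 2) * (μ + a)
        * tricomiIntegral (μ - (a - 1)) (2 * μ) x * hΓ
  · refine (hasDerivAt_whittakerBase hp₁ μ hx).congr_deriv ?_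
    congr 1
    rw [whittakerBase, whittakerBase]
    linear_combination ((x : ℂ) ^ μ * Complex.exp (-(x : ℂ) / 2)
      * (Complex.Gamma (μ - (a - 1)))⁻¹) * (x * tricomiIntegral_add_one_right hp₁ (2 * μ) hx
        - hrec x hx) + (x : ℂ) ^ μ * Complex.exp (-(x : ℂ) / 2)
        * tricomiIntegral (μ - a) (2 * μ) x * hΓ

theorem exists_whittakerPair (hμ : |μ.re| < 1 / 2) (a : ℂ) :
    ∃ A B : ℝ → ℂ, WhittakerPair μ a A B := by
  suffices h : ∀ (n : ℕ) (a : ℂ), 2 ≤ (μ - a).re + n → ∃ A B : ℝ → ℂ, WhittakerPair μ a A B by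
    obtain ⟨n, hn⟩ := exists_nat_ge (2 - (μ - a).re)
    exact h n a (by linarith)
  intro n
  induction n with
  | zero => exact fun a ha => ⟨_, _, whittakerPair_whittakerBase (by simpa using ha) hμ⟩
  | succ n ih =>
    intro a ha
    obtain ⟨A, B, h⟩ := ih (a - 1) (by
      simp only [Complex.sub_re, Complex.one_re] at ha ⊢
      push_cast at ha
      linarith)
    exact ⟨_, _, by simpa only [sub_add_cancel] using h.add_one hμ⟩

theorem isWhittakerW_of_hasDerivAt {κ : ℂ} {y y₁ y₂ : ℝ → ℂ}
    (h₁ : ∀ x : ℝ, 0 < x → HasDerivAt y (y₁ x) x) (h₂ : ∀ x : ℝ, 0 < x → HasDerivAt y₁ (y₂ x) x)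
    (hode : ∀ x : ℝ, 0 < x →
      y₂ x - (1 / 4 - κ / (x : ℂ) + (μ ^ 2 - 1 / 4) / (x : ℂ) ^ 2) * y x = 0)
    (hlim : Tendsto (fun x : ℝ => y x / ((x : ℂ) ^ κ * Complex.exp (-(x : ℂ) / 2))) atTop (𝓝 1)) :
    IsWhittakerW κ μ y := by
  have hderiv : ∀ x : ℝ, 0 < x → HasDerivAt (deriv y) (y₂ x) x := fun x hx =>
    (h₂ x hx).congr_of_eventuallyEq <|
      (eventually_gt_nhds hx).mono fun t ht => (h₁ t ht).deriv
  refine ⟨fun x hx => (h₁ x hx).differentiableAt, fun x hx => (hderiv x hx).differentiableAt,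
    fun x hx => (hderiv x hx).deriv.symm ▸ hode x hx, (isEquivalent_iff_tendsto_one ?_).2 hlim⟩
  filter_upwards [eventually_gt_atTop 0] with x hx using cpow_mul_exp_ne_zero κ hx

theorem hasDerivAt_ofReal_sqrt (hx : 0 < x) :
    HasDerivAt (fun x : ℝ => (√x : ℂ)) ((√x : ℂ) / (2 * x)) x := by
  refine (Real.hasDerivAt_sqrt hx.ne').ofReal_comp.congr_deriv ?_
  have hsqrt : (√x : ℂ) ≠ 0 := Complex.ofReal_ne_zero.2 (Real.sqrt_pos.2 hx).ne'
  have hsq : (√x : ℂ) ^ 2 = x := by rw [← Complex.ofReal_pow, Real.sq_sqrt hx.le]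
  push_cast
  rw [← hsq]
  field_simp

theorem hasDerivAt_sqrt_mul {f : ℝ → ℂ} {f' : ℂ} (hx : 0 < x) (hf : HasDerivAt f (f' / x) x) :
    HasDerivAt (fun x : ℝ => (√x : ℂ) * f x) ((√x : ℂ) * ((f' + f x / 2) / x)) x := by
  have hx0 : (x : ℂ) ≠ 0 := Complex.ofReal_ne_zero.2 hx.ne'
  refine ((hasDerivAt_ofReal_sqrt hx).mul hf).congr_deriv ?_
  field_simp
  ring

theorem tendsto_sqrt_mul_div {f : ℝ → ℂ}
    (hf : Tendsto (fun x : ℝ => f x / ((x : ℂ) ^ a * Complex.exp (-(x : ℂ) / 2))) atTop (𝓝 1)) :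
    Tendsto (fun x : ℝ => (√x : ℂ) * f x / ((x : ℂ) ^ (a + 1 / 2) * Complex.exp (-(x : ℂ) / 2)))
      atTop (𝓝 1) := by
  refine hf.congr' ?_
  filter_upwards [eventually_gt_atTop 0] with x hx
  have hhalf : (x : ℂ) ^ (1 / 2 : ℂ) = √x := by
    rw [Real.sqrt_eq_rpow, Complex.ofReal_cpow hx.le]
    norm_num
  have hsqrt : (√x : ℂ) ≠ 0 := Complex.ofReal_ne_zero.2 (Real.sqrt_pos.2 hx).ne'
  rw [Complex.cpow_add _ _ (Complex.ofReal_ne_zero.2 hx.ne'), hhalf]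
  field_simp

theorem WhittakerPair.isWhittakerW_fst (h : WhittakerPair μ a A B) :
    IsWhittakerW (a + 1 / 2) μ (fun x : ℝ => (√x : ℂ) * A x) := by
  have hderiv := fun (x : ℝ) (hx : 0 < x) =>
    ((((((hasDerivAt_id x).ofReal_comp.div_const 2).const_sub a).mul
      (h.hasDerivAt_fst x hx)).add ((h.hasDerivAt_snd x hx).const_mul (a ^ 2 - μ ^ 2))).add
      ((h.hasDerivAt_fst x hx).div_const 2)).div (hasDerivAt_id x).ofReal_comp
      (Complex.ofReal_ne_zero.2 hx.ne')
  refine isWhittakerW_of_hasDerivAt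
    (fun x hx => hasDerivAt_sqrt_mul hx (h.hasDerivAt_fst x hx))
    (fun x hx => (hasDerivAt_ofReal_sqrt hx).mul (hderiv x hx)) (fun x hx => ?_)
    (tendsto_sqrt_mul_div h.tendsto_fst)
  have hx0 : (x : ℂ) ≠ 0 := Complex.ofReal_ne_zero.2 hx.ne'
  simp only [Pi.add_apply, Pi.mul_apply, id, Complex.ofReal_one]
  field_simp
  ring

theorem WhittakerPair.isWhittakerW_snd (h : WhittakerPair μ a A B) :
    IsWhittakerW (a - 1 / 2) μ (fun x : ℝ => (√x : ℂ) * B x) := by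
  have hderiv := fun (x : ℝ) (hx : 0 < x) =>
    ((((((hasDerivAt_id x).ofReal_comp.div_const 2).sub_const a).mul
      (h.hasDerivAt_snd x hx)).sub (h.hasDerivAt_fst x hx)).add
      ((h.hasDerivAt_snd x hx).div_const 2)).div (hasDerivAt_id x).ofReal_comp
      (Complex.ofReal_ne_zero.2 hx.ne')
  have hlim := tendsto_sqrt_mul_div h.tendsto_snd
  rw [show a - 1 + 1 / 2 = a - 1 / 2 by ring] at hlim
  refine isWhittakerW_of_hasDerivAt
    (fun x hx => hasDerivAt_sqrt_mul hx (h.hasDerivAt_snd x hx))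
    (fun x hx => (hasDerivAt_ofReal_sqrt hx).mul (hderiv x hx)) (fun x hx => ?_) hlim
  have hx0 : (x : ℂ) ≠ 0 := Complex.ofReal_ne_zero.2 hx.ne'
  simp only [Pi.add_apply, Pi.sub_apply, Pi.mul_apply, id, Complex.ofReal_one]
  field_simp
  ring

theorem inv_sqrt_mul_whittakerW {k : ℝ} {κ : ℂ} {f : ℝ → ℂ} (hκ : κ = k)
    (h : IsWhittakerW κ μ fun x : ℝ => (√x : ℂ) * f x) (hx : 0 < x) :
    (((√x)⁻¹ : ℝ) : ℂ) * whittakerW κ μ x = f x := by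
  subst hκ
  rw [whittakerW_eq h hx, ← mul_assoc, ← Complex.ofReal_mul,
    inv_mul_cancel₀ (Real.sqrt_pos.2 hx).ne', Complex.ofReal_one, one_mul]

theorem WhittakerPair.inv_sqrt_mul_whittakerW_fst {a : ℝ} (h : WhittakerPair μ a A B)
    (hx : 0 < x) : (((√x)⁻¹ : ℝ) : ℂ) * whittakerW (a + 1 / 2) μ x = A x :=
  inv_sqrt_mul_whittakerW (k := a + 1 / 2) (by push_cast; rfl) h.isWhittakerW_fst hx

theorem WhittakerPair.inv_sqrt_mul_whittakerW_snd {a : ℝ} (h : WhittakerPair μ a A B)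
    (hx : 0 < x) : (((√x)⁻¹ : ℝ) : ℂ) * whittakerW (a - 1 / 2) μ x = B x :=
  inv_sqrt_mul_whittakerW (k := a - 1 / 2) (by push_cast; rfl) h.isWhittakerW_snd hx

end WhittakerPair

section CoefficientProducts

variable {f g : ℂ → ℂ} {a μ : ℂ}

theorem evenPart_sq_sub_symmSlope_sq (f : ℂ → ℂ) (s : ℂ) :
    evenPart f s ^ 2 - s ^ 2 * symmSlope f s ^ 2 = f s * f (-s) := by
  rw [evenPart, symmSlope]
  split_ifs with h
  · rw [h, neg_zero]
    ring
  · field_simp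
    ring

theorem evenPart_mul_comp_neg (f g : ℂ → ℂ) (s : ℂ) :
    evenPart (fun s => f s * g (-s)) s
      = evenPart f s * evenPart g s - s ^ 2 * (symmSlope f s * symmSlope g s) := by
  simp only [evenPart, symmSlope, neg_neg]
  split_ifs with h
  · rw [h, neg_zero]
    ring
  · field_simp
    ring

theorem symmSlope_mul_comp_neg (hf : DifferentiableAt ℂ f 0) (hg : DifferentiableAt ℂ g 0)
    (s : ℂ) : symmSlope (fun s => f s * g (-s)) s
      = symmSlope f s * evenPart g s - evenPart f s * symmSlope g s := by
  simp only [evenPart, symmSlope, neg_neg]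
  split_ifs with h
  · have hg' : DifferentiableAt ℂ (fun s => g (-s)) 0 := by
      rw [← neg_zero] at hg
      exact hg.comp 0 differentiableAt_id.neg
    rw [deriv_fun_mul hf hg', deriv_comp_neg, h, neg_zero]
    ring
  · field_simp
    ring

theorem symmSlope_mul_of_even (hf : f.Even) (hf' : DifferentiableAt ℂ f 0)
    (hg : DifferentiableAt ℂ g 0) (s : ℂ) :
    symmSlope (fun s => f s * g s) s = f s * symmSlope g s := by
  simp only [symmSlope]
  split_ifs with h
  · have hzero : deriv f 0 = 0 := by
      have hneg := deriv_comp_neg f 0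
      rwa [funext hf, neg_zero, self_eq_neg] at hneg
    rw [deriv_fun_mul hf' hg, hzero, h]
    ring
  · rw [hf s]
    ring

/-- `2 μ / sin (2 π μ)`, continued by `1 / π` to `μ = 0`. -/
def sinRatio (μ : ℂ) : ℂ :=
  if μ = 0 then 1 / (Real.pi : ℂ) else 2 * μ / Complex.sin (2 * Real.pi * μ)

theorem sinRatio_eq (μ : ℂ) :
    sinRatio μ = Complex.Gamma (1 + 2 * μ) * Complex.Gamma (1 - 2 * μ) / Real.pi := by
  rw [sinRatio]
  split_ifs with h
  · simp [h]
  · have hreflect := Complex.Gamma_mul_Gamma_one_sub (2 * μ)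
    have hπ : (Real.pi : ℂ) ≠ 0 := Complex.ofReal_ne_zero.2 Real.pi_ne_zero
    rw [add_comm 1, Complex.Gamma_add_one _ (mul_ne_zero two_ne_zero h), mul_assoc (2 * μ),
      hreflect, show 2 * (Real.pi : ℂ) * μ = Real.pi * (2 * μ) by ring]
    field_simp

theorem even_sinRatio : sinRatio.Even := fun μ => by
  rw [sinRatio_eq, sinRatio_eq, mul_neg, ← sub_eq_add_neg, sub_neg_eq_add, mul_comm]

theorem differentiableAt_sinRatio_zero : DifferentiableAt ℂ sinRatio 0 := by
  have hΓ : ∀ c : ℂ, DifferentiableAt ℂ (fun s => Complex.Gamma (1 + c * s)) 0 := fun c => by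
    have hone : DifferentiableAt ℂ Complex.Gamma (1 + c * 0) := by
      simpa using Complex.differentiableAt_Gamma_one
    exact hone.comp (0 : ℂ) (by fun_prop : DifferentiableAt ℂ (fun s : ℂ => 1 + c * s) 0)
  rw [funext sinRatio_eq]
  simpa only [neg_mul, ← sub_eq_add_neg] using ((hΓ 2).fun_mul (hΓ (-2))).div_const (Real.pi : ℂ)

theorem inv_Gamma_mul_inv_Gamma_neg (z : ℂ) :
    (Complex.Gamma z)⁻¹ * (Complex.Gamma (-z))⁻¹ = -(z * Complex.sin (Real.pi * z) / Real.pi) := by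
  have hreflect := congrArg (·⁻¹) (Complex.Gamma_mul_Gamma_one_sub z)
  simp only [mul_inv, inv_div] at hreflect
  rw [Complex.one_div_Gamma_eq_self_mul_one_div_Gamma_add_one (-z), neg_add_eq_sub]
  linear_combination (-z) * hreflect

theorem connectionGamma_mul_connectionGamma_neg (a s : ℂ) :
    connectionGamma a s * connectionGamma a (-s)
      = Real.pi * sinRatio s * ((Complex.Gamma (s - a))⁻¹ * (Complex.Gamma (-s - a))⁻¹) := by
  have hπ : (Real.pi : ℂ) ≠ 0 := Complex.ofReal_ne_zero.2 Real.pi_ne_zero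
  rw [connectionGamma, connectionGamma, sinRatio_eq, mul_neg, ← sub_eq_add_neg,
    mul_div_cancel₀ _ hπ]
  ring

theorem inv_Gamma_mul_connectionGamma (a μ : ℂ) :
    (Complex.Gamma (a + μ))⁻¹ * (Complex.Gamma (a - μ))⁻¹
      * (connectionGamma a μ * connectionGamma a (-μ))
      = (a ^ 2 - μ ^ 2) * (sinRatio μ * (Complex.sin (Real.pi * (a + μ))
        * Complex.sin (Real.pi * (a - μ))) / Real.pi) := by
  have hadd := inv_Gamma_mul_inv_Gamma_neg (a + μ)
  have hsub := inv_Gamma_mul_inv_Gamma_neg (a - μ)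
  have hπ : (Real.pi : ℂ) ≠ 0 := Complex.ofReal_ne_zero.2 Real.pi_ne_zero
  rw [show -(a + μ) = -μ - a by ring] at hadd
  rw [neg_sub] at hsub
  rw [connectionGamma_mul_connectionGamma_neg]
  calc _ = Real.pi * sinRatio μ
          * (((Complex.Gamma (a + μ))⁻¹ * (Complex.Gamma (-μ - a))⁻¹)
          * ((Complex.Gamma (a - μ))⁻¹ * (Complex.Gamma (μ - a))⁻¹)) := by ring
    _ = _ := by rw [hadd, hsub]; field_simp; ring

theorem connectionGamma_mul_connectionGamma_neg_neg (a s : ℂ) :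
    connectionGamma a s * connectionGamma (-a) (-s)
      = (s - a) * (sinRatio s * Complex.sin (Real.pi * (a - s))) := by
  have hπ : (Real.pi : ℂ) ≠ 0 := Complex.ofReal_ne_zero.2 Real.pi_ne_zero
  have hΓ := inv_Gamma_mul_inv_Gamma_neg (s - a)
  rw [show -(s - a) = -s - -a by ring, ← neg_sub a s, mul_neg, Complex.sin_neg, neg_sub] at hΓ
  rw [connectionGamma, connectionGamma, sinRatio_eq, mul_neg, ← sub_eq_add_neg, mul_mul_mul_comm,
    hΓ]
  field_simp

theorem coefS_sq_sub (μ a : ℂ) : coefS μ a ^ 2 - μ ^ 2 * coefC μ a ^ 2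
    = connectionGamma a μ * connectionGamma a (-μ) := by
  rw [coefS, coefC, neg_sq, evenPart_sq_sub_symmSlope_sq]

theorem evenPart_sin_pi_mul_sub (a μ : ℂ) :
    evenPart (fun s => sinRatio s * Complex.sin (Real.pi * (a - s))) μ
      = sinRatio μ * (Complex.sin (Real.pi * a) * Complex.cos (Real.pi * μ)) := by
  rw [evenPart, even_sinRatio μ, sub_neg_eq_add, mul_sub, mul_add, Complex.sin_sub,
    Complex.sin_add]
  ring

/-- The coefficient of `cosh (μ log (x / y))` in the off-diagonal blocks of the limit kernel. -/
def crossC (μ a : ℂ) : ℂ :=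
  if μ = 0 then Complex.cos (Real.pi * a)
  else Complex.cos (Real.pi * a) * Complex.sin (Real.pi * μ) * sinRatio μ / μ

theorem symmSlope_sin_pi_mul_sub (a μ : ℂ) :
    symmSlope (fun s => sinRatio s * Complex.sin (Real.pi * (a - s))) μ = -crossC μ a := by
  have hsin : HasDerivAt (fun s : ℂ => Complex.sin (Real.pi * (a - s)))
      (Complex.cos (Real.pi * (a - 0)) * (Real.pi * -1)) 0 :=
    (((hasDerivAt_id (0 : ℂ)).const_sub a).const_mul (Real.pi : ℂ)).csin
  have hπ : (Real.pi : ℂ) ≠ 0 := Complex.ofReal_ne_zero.2 Real.pi_ne_zero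
  rw [symmSlope_mul_of_even even_sinRatio differentiableAt_sinRatio_zero hsin.differentiableAt,
    crossC, symmSlope]
  split_ifs with h
  · rw [hsin.deriv, sinRatio, if_pos h, sub_zero]
    field_simp
  · rw [sub_neg_eq_add, mul_sub, mul_add, Complex.sin_sub, Complex.sin_add]
    field_simp
    ring

theorem coefS_mul_coefS_neg (μ a : ℂ) :
    coefS μ a * coefS μ (-a) - μ ^ 2 * (coefC μ a * coefC μ (-a))
      = -μ ^ 2 * crossC μ a
        - a * (sinRatio μ * (Complex.sin (Real.pi * a) * Complex.cos (Real.pi * μ))) := by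
  rw [coefS, coefS, neg_mul_neg, coefC, coefC, ← evenPart_mul_comp_neg,
    funext (connectionGamma_mul_connectionGamma_neg_neg a), evenPart_sub_mul,
    evenPart_sin_pi_mul_sub, symmSlope_sin_pi_mul_sub]
  ring

theorem coefS_mul_coefC_neg (μ a : ℂ) :
    coefS μ a * coefC μ (-a) - coefC μ a * coefS μ (-a)
      = sinRatio μ * (Complex.sin (Real.pi * a) * Complex.cos (Real.pi * μ)) + a * crossC μ a := by
  have hdiff : DifferentiableAt ℂ (fun s => sinRatio s * Complex.sin (Real.pi * (a - s))) 0 :=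
    differentiableAt_sinRatio_zero.mul (by fun_prop)
  have hmul := symmSlope_mul_comp_neg (hasDerivAt_connectionGamma a).differentiableAt
    (hasDerivAt_connectionGamma (-a)).differentiableAt μ
  rw [funext (connectionGamma_mul_connectionGamma_neg_neg a), symmSlope_sub_mul hdiff,
    evenPart_sin_pi_mul_sub, symmSlope_sin_pi_mul_sub] at hmul
  rw [coefS, coefS, coefC, coefC]
  linear_combination -hmul

theorem mul_sinhDiv (μ τ : ℂ) : μ * sinhDiv μ τ = Complex.sinh (μ * τ) := by
  rw [sinhDiv]
  split_ifs with h
  · simp [h]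
  · rw [mul_div_cancel₀ _ h]

theorem sinhDiv_sub (μ s t : ℂ) : sinhDiv μ (s - t)
    = sinhDiv μ s * Complex.cosh (μ * t) - Complex.cosh (μ * s) * sinhDiv μ t := by
  simp only [sinhDiv]
  split_ifs with h
  · simp [h]
  · rw [mul_sub, Complex.sinh_sub]
    ring

theorem cosh_mul_sub (μ s t : ℂ) : Complex.cosh (μ * (s - t))
    = Complex.cosh (μ * s) * Complex.cosh (μ * t) - μ ^ 2 * (sinhDiv μ s * sinhDiv μ t) := by
  rw [mul_sub, Complex.cosh_sub, ← mul_sinhDiv, ← mul_sinhDiv]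
  ring

theorem sinhDiv_neg (μ s : ℂ) : sinhDiv μ (-s) = -sinhDiv μ s := by
  simp only [sinhDiv]
  split_ifs with h
  · rfl
  · rw [mul_neg, Complex.sinh_neg, neg_div]

theorem sq_sub_sq_mul_zeroMain (μ a : ℂ) (x : ℝ) : (a ^ 2 - μ ^ 2) * zeroMain μ (a - 1) x
    = (coefS μ a - a * coefC μ a) * Complex.cosh (μ * Real.log x)
      + (μ ^ 2 * coefC μ a - a * coefS μ a) * sinhDiv μ (Real.log x) := by
  rw [← sq_sub_sq_mul_coefC, ← sq_sub_sq_mul_coefS, zeroMain]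
  ring

theorem zeroMain_wronskian (hne : a ^ 2 - μ ^ 2 ≠ 0) (x y : ℝ) :
    zeroMain μ a x * zeroMain μ (a - 1) y - zeroMain μ (a - 1) x * zeroMain μ a y
      = connectionGamma a μ * connectionGamma a (-μ) / (a ^ 2 - μ ^ 2)
        * sinhDiv μ (Real.log x - Real.log y) := by
  rw [sinhDiv_sub, div_mul_eq_mul_div, eq_div_iff hne, ← coefS_sq_sub]
  calc _ = zeroMain μ a x * ((a ^ 2 - μ ^ 2) * zeroMain μ (a - 1) y)
        - (a ^ 2 - μ ^ 2) * zeroMain μ (a - 1) x * zeroMain μ a y := by ring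
    _ = _ := by rw [sq_sub_sq_mul_zeroMain, sq_sub_sq_mul_zeroMain, zeroMain, zeroMain]; ring

theorem zeroMain_quadratic (hne : a ^ 2 - μ ^ 2 ≠ 0) (x : ℝ) :
    zeroMain μ a x * zeroMain μ a x
      + (a ^ 2 - μ ^ 2) * (zeroMain μ (a - 1) x * zeroMain μ (a - 1) x)
      + 2 * a * (zeroMain μ a x * zeroMain μ (a - 1) x)
      = connectionGamma a μ * connectionGamma a (-μ) / (a ^ 2 - μ ^ 2) := by
  have hcosh := cosh_mul_sub μ (Real.log x) (Real.log x)
  rw [sub_self, mul_zero, Complex.cosh_zero] at hcosh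
  rw [eq_div_iff hne, ← coefS_sq_sub]
  set w := (a ^ 2 - μ ^ 2) * zeroMain μ (a - 1) x with hw
  rw [sq_sub_sq_mul_zeroMain] at hw
  calc _ = (a ^ 2 - μ ^ 2) * zeroMain μ a x ^ 2 + w ^ 2 + 2 * a * zeroMain μ a x * w := by ring
    _ = _ := by
      rw [hw, zeroMain]
      linear_combination (μ ^ 2 * coefC μ a ^ 2 - coefS μ a ^ 2) * hcosh

theorem zeroMain_cross (hne : a ^ 2 - μ ^ 2 ≠ 0) (x y : ℝ) :
    zeroMain μ a x * zeroMain μ (-a) y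
      + (a ^ 2 - μ ^ 2) * (zeroMain μ (a - 1) x * zeroMain μ (-a - 1) y)
      = crossC μ a * Complex.cosh (μ * (Real.log x - Real.log y))
        + sinRatio μ * (Complex.sin (Real.pi * a) * Complex.cos (Real.pi * μ))
          * sinhDiv μ (Real.log x - Real.log y) := by
  have hy := sq_sub_sq_mul_zeroMain μ (-a) y
  rw [neg_sq] at hy
  have hSS := coefS_mul_coefS_neg μ a
  have hSC := coefS_mul_coefC_neg μ a
  refine mul_left_cancel₀ hne ?_
  rw [sinhDiv_sub, cosh_mul_sub]
  calc _ = (a ^ 2 - μ ^ 2) * zeroMain μ a x * zeroMain μ (-a) y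
        + (a ^ 2 - μ ^ 2) * zeroMain μ (a - 1) x
          * ((a ^ 2 - μ ^ 2) * zeroMain μ (-a - 1) y) := by ring
    _ = _ := by
      rw [sq_sub_sq_mul_zeroMain, hy, zeroMain, zeroMain]
      linear_combination (hSS + a * hSC)
          * (Complex.cosh (μ * Real.log x) * Complex.cosh (μ * Real.log y)
            - μ ^ 2 * (sinhDiv μ (Real.log x) * sinhDiv μ (Real.log y)))
        - (μ ^ 2 * hSC + a * hSS) * (sinhDiv μ (Real.log x) * Complex.cosh (μ * Real.log y)
            - Complex.cosh (μ * Real.log x) * sinhDiv μ (Real.log y))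

end CoefficientProducts

section Admissible

variable {z z' : ℂ}

theorem pi_mul_mem_Ioo {t : ℝ} (ht : t ∈ Ioo (0 : ℝ) 1) : Real.pi * t ∈ Ioo 0 Real.pi :=
  ⟨mul_pos Real.pi_pos ht.1, mul_lt_of_lt_one_right Real.pi_pos ht.2⟩

theorem sin_pi_mul_eq (t : ℝ) (m : ℤ) :
    Real.sin (Real.pi * t) = (-1) ^ m * Real.sin (Real.pi * (t - m)) := by
  rw [← Real.sin_add_int_mul_pi]
  congr 1
  ring

theorem sin_mul_sin_pos {m : ℤ} {r r' : ℝ} (hr : r ∈ Ioo (m : ℝ) (m + 1))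
    (hr' : r' ∈ Ioo (m : ℝ) (m + 1)) : 0 < Real.sin (Real.pi * r) * Real.sin (Real.pi * r') := by
  have hpos : ∀ t ∈ Ioo (m : ℝ) (m + 1), 0 < Real.sin (Real.pi * (t - m)) := fun t ht =>
    Real.sin_pos_of_mem_Ioo (pi_mul_mem_Ioo ⟨by linarith [ht.1], by linarith [ht.2]⟩)
  have hsign : ((-1 : ℝ) ^ m) * (-1) ^ m = 1 := by
    rw [← mul_zpow]
    simp
  rw [sin_pi_mul_eq r m, sin_pi_mul_eq r' m, mul_mul_mul_comm, hsign, one_mul]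
  exact mul_pos (hpos r hr) (hpos r' hr')

theorem div_sin_pos {t : ℝ} (h₀ : t ≠ 0) (h₁ : |t| < 1) : 0 < t / Real.sin (Real.pi * t) := by
  obtain ⟨hl, hr⟩ := abs_lt.1 h₁
  rcases h₀.lt_or_gt with h | h
  · refine div_pos_of_neg_of_neg h ?_
    rw [← neg_neg t, mul_neg, Real.sin_neg, neg_lt_zero]
    exact Real.sin_pos_of_mem_Ioo (pi_mul_mem_Ioo ⟨by linarith, by linarith⟩)
  · exact div_pos h (Real.sin_pos_of_mem_Ioo (pi_mul_mem_Ioo ⟨h, hr⟩))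

theorem div_sinh_pos {t : ℝ} (h : t ≠ 0) : 0 < t / Real.sinh (Real.pi * t) := by
  rcases h.lt_or_gt with h | h
  · exact div_pos_of_neg_of_neg h (Real.sinh_neg_iff.2 (mul_neg_of_pos_of_neg Real.pi_pos h))
  · exact div_pos h (Real.sinh_pos_iff.2 (mul_pos Real.pi_pos h))

theorem exists_sinRatio_ofReal {t : ℝ} (ht : |t| < 1 / 2) : ∃ r : ℝ, 0 < r ∧ sinRatio t = r := by
  rcases eq_or_ne t 0 with rfl | h
  · exact ⟨1 / Real.pi, by positivity, by simp [sinRatio]⟩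
  · refine ⟨2 * t / Real.sin (Real.pi * (2 * t)), div_sin_pos (by simpa) ?_, ?_⟩
    · rw [abs_mul, abs_two]
      linarith
    · rw [sinRatio, if_neg (Complex.ofReal_ne_zero.2 h), mul_comm 2 (Real.pi : ℂ), mul_assoc]
      push_cast
      rfl

theorem exists_sinRatio_ofReal_mul_I (t : ℝ) :
    ∃ r : ℝ, 0 < r ∧ sinRatio (t * Complex.I) = r := by
  rcases eq_or_ne t 0 with rfl | h
  · exact ⟨1 / Real.pi, by positivity, by simp [sinRatio]⟩
  · refine ⟨2 * t / Real.sinh (Real.pi * (2 * t)), div_sinh_pos (by simpa), ?_⟩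
    rw [sinRatio, if_neg (mul_ne_zero (Complex.ofReal_ne_zero.2 h) Complex.I_ne_zero),
      show 2 * (Real.pi : ℂ) * (t * Complex.I) = Real.pi * (2 * t) * Complex.I by ring,
      Complex.sin_mul_I, ← mul_assoc, mul_div_mul_right _ _ Complex.I_ne_zero]
    push_cast
    rfl

theorem parMu_conj (z : ℂ) : parMu z ((starRingEnd ℂ) z) = z.im * Complex.I := by
  rw [parMu, Complex.sub_conj]
  push_cast
  ring

theorem parMu_ofReal (r r' : ℝ) : parMu r r' = ((r - r') / 2 : ℝ) := by
  rw [parMu]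
  push_cast
  rfl

theorem abs_sub_div_two_lt {m : ℤ} {r r' : ℝ} (hr : r ∈ Ioo (m : ℝ) (m + 1))
    (hr' : r' ∈ Ioo (m : ℝ) (m + 1)) : |(r - r') / 2| < 1 / 2 :=
  abs_lt.2 ⟨by linarith [hr.1, hr'.2], by linarith [hr.2, hr'.1]⟩

theorem Admissible.exists_parA_eq (h : Admissible z z') : ∃ a : ℝ, parA z z' = a := by
  rcases h with ⟨rfl, -⟩ | ⟨r, r', rfl, rfl, -⟩
  · exact ⟨z.re, by rw [parA, Complex.add_conj]; push_cast; ring⟩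
  · exact ⟨(r + r') / 2, by rw [parA]; push_cast; rfl⟩

theorem Admissible.abs_re_parMu_lt (h : Admissible z z') : |(parMu z z').re| < 1 / 2 := by
  rcases h with ⟨rfl, -⟩ | ⟨r, r', rfl, rfl, m, hr, hr₁, hr', hr₁'⟩
  · rw [parMu_conj]
    simp
  · rw [parMu_ofReal, Complex.ofReal_re]
    exact abs_sub_div_two_lt ⟨hr, hr₁⟩ ⟨hr', hr₁'⟩

theorem Admissible.mul_ne_zero (h : Admissible z z') : z * z' ≠ 0 := by
  rcases h with ⟨rfl, hz⟩ | ⟨r, r', rfl, rfl, m, hr, hr₁, hr', hr₁'⟩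
  · have hz₀ : z ≠ 0 := by simpa using hz 0
    exact _root_.mul_ne_zero hz₀ (by simpa using hz₀)
  · have hpos := sin_mul_sin_pos ⟨hr, hr₁⟩ ⟨hr', hr₁'⟩
    refine _root_.mul_ne_zero (Complex.ofReal_ne_zero.2 ?_) (Complex.ofReal_ne_zero.2 ?_) <;>
      · rintro rfl
        simp at hpos

theorem Admissible.exists_sinProd_eq (h : Admissible z z') :
    ∃ s : ℝ, 0 < s ∧ sinProd z z' = s := by
  rcases h with ⟨rfl, hz⟩ | ⟨r, r', rfl, rfl, m, hr, hr₁, hr', hr₁'⟩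
  · have hsin : Complex.sin (Real.pi * z) ≠ 0 := fun hzero => by
      obtain ⟨k, hk⟩ := Complex.sin_eq_zero_iff.1 hzero
      exact hz k (mul_left_cancel₀ (Complex.ofReal_ne_zero.2 Real.pi_ne_zero)
        (hk.trans (mul_comm _ _)))
    refine ⟨Complex.normSq (Complex.sin (Real.pi * z)), Complex.normSq_pos.2 hsin, ?_⟩
    rw [sinProd, ← Complex.mul_conj, ← Complex.sin_conj, map_mul, Complex.conj_ofReal]
  · refine ⟨_, sin_mul_sin_pos ⟨hr, hr₁⟩ ⟨hr', hr₁'⟩, ?_⟩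
    rw [sinProd]
    push_cast
    rfl

theorem Admissible.exists_sinRatio_eq (h : Admissible z z') :
    ∃ r : ℝ, 0 < r ∧ sinRatio (parMu z z') = r := by
  rcases h with ⟨rfl, -⟩ | ⟨r, r', rfl, rfl, m, hr, hr₁, hr', hr₁'⟩
  · rw [parMu_conj]
    exact exists_sinRatio_ofReal_mul_I _
  · rw [parMu_ofReal]
    exact exists_sinRatio_ofReal (abs_sub_div_two_lt ⟨hr, hr₁⟩ ⟨hr', hr₁'⟩)

theorem Admissible.sigma_pos (h : Admissible z z') : 0 < sigma z z' := by
  obtain ⟨s, hs, hprod⟩ := h.exists_sinProd_eq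
  rw [sigma, hprod]
  exact Real.sqrt_pos.2 hs

theorem Admissible.sigma_sq (h : Admissible z z') : (sigma z z' : ℂ) ^ 2 = sinProd z z' := by
  obtain ⟨s, hs, hprod⟩ := h.exists_sinProd_eq
  rw [sigma, hprod, Complex.ofReal_re, ← Complex.ofReal_pow, Real.sq_sqrt hs.le]

theorem scaleComplex_eq (z z' : ℂ) : scaleComplex z z'
    = sinRatio (parMu z z') * (sigma z z' : ℂ) ^ 2 / Real.pi := by
  rw [scaleComplex, sinRatio]
  split_ifs with h
  · field_simp
  · simp only [div_eq_mul_inv, mul_inv]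
    ring

theorem Admissible.exists_scaleComplex_eq (h : Admissible z z') :
    ∃ c : ℝ, 0 < c ∧ scaleComplex z z' = c := by
  obtain ⟨r, hr, hratio⟩ := h.exists_sinRatio_eq
  have hσ := h.sigma_pos
  refine ⟨r * sigma z z' ^ 2 / Real.pi, by positivity, ?_⟩
  rw [scaleComplex_eq, hratio]
  push_cast
  rfl

theorem Admissible.scale_pos (h : Admissible z z') : 0 < scale z z' := by
  obtain ⟨c, hc, hscale⟩ := h.exists_scaleComplex_eq
  rwa [scale, hscale]

theorem Admissible.ofReal_scale (h : Admissible z z') :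
    (scale z z' : ℂ) = scaleComplex z z' := by
  obtain ⟨c, -, hscale⟩ := h.exists_scaleComplex_eq
  rw [scale, hscale, Complex.ofReal_re]

theorem constBComplex_eq (z z' : ℂ) : constBComplex z z' = 1 / (2 * scaleComplex z z') := by
  rw [scaleComplex, constBComplex]
  split_ifs with h
  · field_simp
  · simp only [div_eq_mul_inv, mul_inv, inv_inv]
    ring

theorem Admissible.constBComplex_eq_ofReal (h : Admissible z z') :
    constBComplex z z' = (1 / (2 * scale z z') : ℝ) := by
  rw [constBComplex_eq, ← h.ofReal_scale]
  push_cast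
  rfl

theorem Admissible.constB_eq (h : Admissible z z') : constB z z' = 1 / (2 * scale z z') := by
  rw [constB, h.constBComplex_eq_ofReal, Complex.ofReal_re]

theorem Admissible.constB_pos (h : Admissible z z') : 0 < constB z z' := by
  have hc := h.scale_pos
  rw [h.constB_eq]
  positivity

theorem Admissible.ofReal_constB (h : Admissible z z') :
    (constB z z' : ℂ) = constBComplex z z' := by
  rw [h.constB_eq, h.constBComplex_eq_ofReal]

theorem constA_eq (z z' : ℂ) : constA z z' = 2 * parMu z z' * constBComplex z z' := by
  rw [constA, constBComplex]
  split_ifs with h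
  · simp [h]
  · field_simp
    ring

theorem Admissible.constA_eq_div (h : Admissible z z') :
    constA z z' = parMu z z' / scale z z' := by
  rw [constA_eq, h.constBComplex_eq_ofReal]
  push_cast
  ring

end Admissible

section Limits

variable {α : Type*} {l : Filter α} {X Y : α → ℝ} {q : ℝ} {μ a : ℂ} {A B A' B' : ℝ → ℂ}

theorem tendsto_mul_of_isBigO {F G : ℝ → ℂ} {r : ℝ} (hF : F =O[𝓝[>] 0] fun x : ℝ => x ^ r)
    (hG : G =o[𝓝[>] 0] fun x : ℝ => x ^ (-r)) (hq : 0 < q) (hX : Tendsto X l (𝓝[>] 0))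
    (hY : Tendsto Y l (𝓝[>] 0)) (hXY : ∀ t, X t = q * Y t) :
    Tendsto (fun t => F (X t) * G (Y t)) l (𝓝 0) := by
  have hprod : (fun t => F (X t) * G (Y t)) =o[l] fun _ => q ^ r := by
    refine ((hF.comp_tendsto hX).mul_isLittleO (hG.comp_tendsto hY)).congr' EventuallyEq.rfl ?_
    filter_upwards [hY.eventually self_mem_nhdsWithin] with t (ht : 0 < Y t)
    simp only [Function.comp]
    rw [hXY, Real.mul_rpow hq.le ht.le, mul_assoc, ← Real.rpow_add ht, add_neg_cancel,
      Real.rpow_zero, mul_one]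
  exact (isLittleO_const_iff (Real.rpow_pos_of_pos hq r).ne').1 hprod

theorem tendsto_mul_sub_mul {f g m n : ℝ → ℂ}
    (hf : (fun x => f x - m x) =O[𝓝[>] 0] fun x : ℝ => x ^ (1 / 2 : ℝ))
    (hg : (fun x => g x - n x) =O[𝓝[>] 0] fun x : ℝ => x ^ (1 / 2 : ℝ))
    (hm : m =o[𝓝[>] 0] fun x : ℝ => x ^ (-1 / 2 : ℝ))
    (hg' : g =o[𝓝[>] 0] fun x : ℝ => x ^ (-1 / 2 : ℝ)) (hq : 0 < q)
    (hX : Tendsto X l (𝓝[>] 0)) (hY : Tendsto Y l (𝓝[>] 0)) (hXY : ∀ t, X t = q * Y t) :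
    Tendsto (fun t => f (X t) * g (Y t) - m (X t) * n (Y t)) l (𝓝 0) := by
  rw [neg_div] at hm hg'
  have hfst := tendsto_mul_of_isBigO hf hg' hq hX hY hXY
  have hsnd := tendsto_mul_of_isBigO hg hm (inv_pos.2 hq) hY hX
    fun t => by rw [hXY, inv_mul_cancel_left₀ hq.ne']
  simpa using (hfst.add hsnd).congr fun t => by ring

theorem tendsto_mul_sub_zeroMain_mul {f g : ℝ → ℂ} {b : ℂ} (hμ : |μ.re| < 1 / 2)
    (hf : (fun x => f x - zeroMain μ a x) =O[𝓝[>] 0] fun x : ℝ => x ^ (1 / 2 : ℝ))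
    (hg : (fun x => g x - zeroMain μ b x) =O[𝓝[>] 0] fun x : ℝ => x ^ (1 / 2 : ℝ)) (hq : 0 < q)
    (hX : Tendsto X l (𝓝[>] 0)) (hY : Tendsto Y l (𝓝[>] 0)) (hXY : ∀ t, X t = q * Y t) :
    Tendsto (fun t => f (X t) * g (Y t) - zeroMain μ a (X t) * zeroMain μ b (Y t)) l (𝓝 0) :=
  tendsto_mul_sub_mul hf hg (isLittleO_zeroMain hμ a) (isLittleO_of_sub_zeroMain_isBigO hμ hg)
    hq hX hY hXY

theorem log_sub_log_of_eq_mul {x y : ℝ} (hq : 0 < q) (hy : 0 < y) (h : x = q * y) :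
    (Real.log x : ℂ) - (Real.log y : ℂ) = (Real.log q : ℂ) := by
  rw [h, Real.log_mul hq.ne' hy.ne', Complex.ofReal_add, add_sub_cancel_right]

theorem WhittakerPair.tendsto_wronskian (h : WhittakerPair μ a A B) (hμ : |μ.re| < 1 / 2)
    (hne : a ^ 2 - μ ^ 2 ≠ 0) (hq : 0 < q) (hX : Tendsto X l (𝓝[>] 0))
    (hY : Tendsto Y l (𝓝[>] 0)) (hXY : ∀ t, X t = q * Y t) :
    Tendsto (fun t => A (X t) * B (Y t) - B (X t) * A (Y t)) l
      (𝓝 (connectionGamma a μ * connectionGamma a (-μ) / (a ^ 2 - μ ^ 2)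
        * sinhDiv μ (Real.log q))) := by
  have hAB := tendsto_mul_sub_zeroMain_mul hμ h.isBigO_fst h.isBigO_snd hq hX hY hXY
  have hBA := tendsto_mul_sub_zeroMain_mul hμ h.isBigO_snd h.isBigO_fst hq hX hY hXY
  have hlim := (hAB.sub hBA).add_const
    (connectionGamma a μ * connectionGamma a (-μ) / (a ^ 2 - μ ^ 2) * sinhDiv μ (Real.log q))
  rw [sub_zero, zero_add] at hlim
  refine hlim.congr' ?_
  filter_upwards [hY.eventually self_mem_nhdsWithin] with t ht
  rw [← log_sub_log_of_eq_mul hq ht (hXY t), ← zeroMain_wronskian hne]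
  ring

theorem WhittakerPair.tendsto_cross (h : WhittakerPair μ a A B)
    (h' : WhittakerPair μ (-a) A' B') (hμ : |μ.re| < 1 / 2) (hne : a ^ 2 - μ ^ 2 ≠ 0)
    (hq : 0 < q) (hX : Tendsto X l (𝓝[>] 0)) (hY : Tendsto Y l (𝓝[>] 0))
    (hXY : ∀ t, X t = q * Y t) :
    Tendsto (fun t => A (X t) * A' (Y t) + (a ^ 2 - μ ^ 2) * (B (X t) * B' (Y t))) l
      (𝓝 (crossC μ a * Complex.cosh (μ * Real.log q)
        + sinRatio μ * (Complex.sin (Real.pi * a) * Complex.cos (Real.pi * μ))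
          * sinhDiv μ (Real.log q))) := by
  have hAA := tendsto_mul_sub_zeroMain_mul hμ h.isBigO_fst h'.isBigO_fst hq hX hY hXY
  have hBB := tendsto_mul_sub_zeroMain_mul hμ h.isBigO_snd h'.isBigO_snd hq hX hY hXY
  have hlim := (hAA.add (hBB.const_mul (a ^ 2 - μ ^ 2))).add_const
    (crossC μ a * Complex.cosh (μ * Real.log q)
      + sinRatio μ * (Complex.sin (Real.pi * a) * Complex.cos (Real.pi * μ))
        * sinhDiv μ (Real.log q))
  rw [mul_zero, zero_add, zero_add] at hlim
  refine hlim.congr' ?_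
  filter_upwards [hY.eventually self_mem_nhdsWithin] with t ht
  rw [← log_sub_log_of_eq_mul hq ht (hXY t), ← zeroMain_cross hne]
  ring

theorem WhittakerPair.tendsto_mul_wronskian_deriv (h : WhittakerPair μ a A B)
    (hμ : |μ.re| < 1 / 2) (hne : a ^ 2 - μ ^ 2 ≠ 0) (hX : Tendsto X l (𝓝[>] 0)) :
    Tendsto (fun t => X t * (deriv A (X t) * B (X t) - deriv B (X t) * A (X t))) l
      (𝓝 (connectionGamma a μ * connectionGamma a (-μ) / (a ^ 2 - μ ^ 2))) := by
  have hXX : ∀ t, X t = 1 * X t := fun t => (one_mul _).symm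
  have hAA := tendsto_mul_sub_zeroMain_mul hμ h.isBigO_fst h.isBigO_fst one_pos hX hX hXX
  have hBB := tendsto_mul_sub_zeroMain_mul hμ h.isBigO_snd h.isBigO_snd one_pos hX hX hXX
  have hAB := tendsto_mul_sub_zeroMain_mul hμ h.isBigO_fst h.isBigO_snd one_pos hX hX hXX
  have hxA := isBigO_mul_rpow_nhdsGT_zero (isBigO_ofReal_cpow_nhdsGT_zero 1)
    (isLittleO_of_sub_zeroMain_isBigO hμ h.isBigO_fst).isBigO
  rw [show (1 : ℂ).re + -1 / 2 = 1 / 2 by norm_num] at hxA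
  have hB := isLittleO_of_sub_zeroMain_isBigO hμ h.isBigO_snd
  rw [neg_div] at hB
  have hxAB := tendsto_mul_of_isBigO hxA hB one_pos hX hX hXX
  have hlim := (((hAA.add (hBB.const_mul (a ^ 2 - μ ^ 2))).add (hAB.const_mul (2 * a))).sub
    hxAB).add_const (connectionGamma a μ * connectionGamma a (-μ) / (a ^ 2 - μ ^ 2))
  simp only [mul_zero, zero_add, sub_zero] at hlim
  refine hlim.congr' ?_
  filter_upwards [hX.eventually self_mem_nhdsWithin] with t (ht : 0 < X t)
  have ht₀ : (X t : ℂ) ≠ 0 := Complex.ofReal_ne_zero.2 ht.ne'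
  rw [(h.hasDerivAt_fst _ ht).deriv, (h.hasDerivAt_snd _ ht).deriv, Complex.cpow_one,
    ← zeroMain_quadratic hne (X t)]
  field_simp
  ring

end Limits

section LogarithmicVariable

variable {c : ℝ} {μ a : ℂ} {A B A' B' : ℝ → ℂ}

theorem tendsto_expVar (hc : 0 < c) (ξ : ℝ) :
    Tendsto (fun M : ℝ => expVar c (ξ + M)) atTop (𝓝[>] 0) := by
  refine tendsto_nhdsWithin_iff.2 ⟨?_, Eventually.of_forall fun M => Real.exp_pos _⟩
  exact Real.tendsto_exp_atBot.comp ((tendsto_neg_atTop_atBot.comp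
    (tendsto_atTop_add_const_left _ ξ tendsto_id)).atBot_div_const hc)

theorem expVar_pos (c ξ : ℝ) : 0 < expVar c ξ := Real.exp_pos _

theorem expVar_eq_mul (c ξ η M : ℝ) :
    expVar c (ξ + M) = Real.exp (-(ξ - η) / c) * expVar c (η + M) := by
  rw [expVar, expVar, ← Real.exp_add]
  congr 1
  ring

theorem expVar_injective (hc : 0 < c) : Function.Injective (expVar c) := fun ξ η h => by
  have hexp := Real.exp_injective h
  rwa [div_left_inj' hc.ne', neg_inj] at hexp

/-- The factor `|dx/dξ| ^ (1/2) * |dy/dη| ^ (1/2)` by which a kernel is multiplied under the change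
of variables `x = e ^ (-ξ/c)`, `y = e ^ (-η/c)`. -/
def halfDensity (c ξ η : ℝ) : ℝ := √(expVar c ξ / c) * √(expVar c η / c)

theorem halfDensity_comm (c ξ η : ℝ) : halfDensity c ξ η = halfDensity c η ξ := mul_comm _ _

theorem halfDensity_self (hc : 0 < c) (ξ : ℝ) : halfDensity c ξ ξ = expVar c ξ / c :=
  Real.mul_self_sqrt (div_nonneg (expVar_pos c ξ).le hc.le)

theorem halfDensity_eq (hc : 0 < c) (ξ η : ℝ) :
    halfDensity c ξ η = Real.exp (-(ξ + η) / (2 * c)) / c := by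
  have hsq : expVar c ξ / c * (expVar c η / c) = (Real.exp (-(ξ + η) / (2 * c)) / c) ^ 2 := by
    rw [expVar, expVar, div_mul_div_comm, ← Real.exp_add, div_pow, ← Real.exp_nat_mul, sq c]
    congr 2
    push_cast
    field_simp
    ring
  rw [halfDensity, ← Real.sqrt_mul (div_nonneg (expVar_pos c ξ).le hc.le), hsq]
  exact Real.sqrt_sq (by positivity)

theorem expVar_left_eq_exp_mul (hc : 0 < c) (ξ η : ℝ) :
    expVar c ξ = Real.exp (-((ξ - η) / (2 * c))) * (c * halfDensity c ξ η) := by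
  rw [halfDensity_eq hc, mul_div_cancel₀ _ hc.ne', ← Real.exp_add, expVar]
  congr 1
  field_simp
  ring

theorem expVar_right_eq_exp_mul (hc : 0 < c) (ξ η : ℝ) :
    expVar c η = Real.exp ((ξ - η) / (2 * c)) * (c * halfDensity c ξ η) := by
  rw [expVar_left_eq_exp_mul hc η ξ, halfDensity_comm, ← neg_div, neg_sub]

theorem expVar_sub_expVar (hc : 0 < c) (ξ η : ℝ) : expVar c ξ - expVar c η
    = -(2 * c * Real.sinh ((ξ - η) / (2 * c))) * halfDensity c ξ η := by
  rw [expVar_left_eq_exp_mul hc ξ η, expVar_right_eq_exp_mul hc ξ η, Real.sinh_eq]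
  ring

theorem expVar_add_expVar (hc : 0 < c) (ξ η : ℝ) : expVar c ξ + expVar c η
    = 2 * c * Real.cosh ((ξ - η) / (2 * c)) * halfDensity c ξ η := by
  rw [expVar_left_eq_exp_mul hc ξ η, expVar_right_eq_exp_mul hc ξ η, Real.cosh_eq]
  ring

theorem halfDensity_pos (hc : 0 < c) (ξ η : ℝ) : 0 < halfDensity c ξ η := by
  rw [halfDensity_eq hc]
  positivity

theorem halfDensity_div_sub (hc : 0 < c) (ξ η : ℝ) :
    halfDensity c ξ η / (expVar c ξ - expVar c η) = -(2 * c * Real.sinh ((ξ - η) / (2 * c)))⁻¹ := by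
  rw [expVar_sub_expVar hc, div_mul_cancel_right₀ (halfDensity_pos hc ξ η).ne', inv_neg]

theorem halfDensity_div_add (hc : 0 < c) (ξ η : ℝ) :
    halfDensity c ξ η / (expVar c ξ + expVar c η) = (2 * c * Real.cosh ((ξ - η) / (2 * c)))⁻¹ := by
  rw [expVar_add_expVar hc, div_mul_cancel_right₀ (halfDensity_pos hc ξ η).ne']

/-- The limit of a diagonal block of the kernel in the variables `ξ`, `η` with `ζ = ξ - η`. -/
def diagLimit (μ : ℂ) (c ζ : ℝ) : ℂ :=
  if ζ = 0 then 1 else sinhDiv μ (ζ / c : ℝ) / (2 * Real.sinh (ζ / (2 * c)))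

theorem WhittakerPair.tendsto_diag_self (h : WhittakerPair μ a A B) (hμ : |μ.re| < 1 / 2)
    (hne : a ^ 2 - μ ^ 2 ≠ 0) (hc : 0 < c) {g : ℂ}
    (hg : g * (connectionGamma a μ * connectionGamma a (-μ) / (a ^ 2 - μ ^ 2)) = c) (ξ : ℝ) :
    Tendsto (fun M : ℝ => (halfDensity c (ξ + M) (ξ + M) : ℂ)
      * (g * divDiffKernel A B (expVar c (ξ + M)) (expVar c (ξ + M)))) atTop (𝓝 1) := by
  have hlim := ((h.tendsto_mul_wronskian_deriv hμ hne (tendsto_expVar hc ξ)).const_mul g).const_mul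
    (c : ℂ)⁻¹
  rw [hg, inv_mul_cancel₀ (Complex.ofReal_ne_zero.2 hc.ne')] at hlim
  refine hlim.congr fun M => ?_
  rw [divDiffKernel, if_pos rfl, halfDensity_self hc]
  push_cast
  ring

theorem WhittakerPair.tendsto_diag_of_ne (h : WhittakerPair μ a A B) (hμ : |μ.re| < 1 / 2)
    (hne : a ^ 2 - μ ^ 2 ≠ 0) (hc : 0 < c) {g : ℂ}
    (hg : g * (connectionGamma a μ * connectionGamma a (-μ) / (a ^ 2 - μ ^ 2)) = c) {ξ η : ℝ}
    (hξη : ξ ≠ η) :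
    Tendsto (fun M : ℝ => (halfDensity c (ξ + M) (η + M) : ℂ)
      * (g * divDiffKernel A B (expVar c (ξ + M)) (expVar c (η + M)))) atTop
      (𝓝 (sinhDiv μ ((ξ - η) / c : ℝ) / (2 * Real.sinh ((ξ - η) / (2 * c))))) := by
  have hlim := ((h.tendsto_wronskian hμ hne (Real.exp_pos _) (tendsto_expVar hc ξ)
    (tendsto_expVar hc η) (expVar_eq_mul c ξ η)).const_mul g).const_mul
    ((-(2 * c * Real.sinh ((ξ - η) / (2 * c)))⁻¹ : ℝ) : ℂ)
  have hval : ((-(2 * c * Real.sinh ((ξ - η) / (2 * c)))⁻¹ : ℝ) : ℂ)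
      * (c * sinhDiv μ (Real.log (Real.exp (-(ξ - η) / c))))
      = sinhDiv μ ((ξ - η) / c : ℝ) / (2 * Real.sinh ((ξ - η) / (2 * c))) := by
    have hc₀ : (c : ℂ) ≠ 0 := Complex.ofReal_ne_zero.2 hc.ne'
    rw [Real.log_exp, neg_div, Complex.ofReal_neg ((ξ - η) / c), sinhDiv_neg]
    push_cast
    field_simp
  rw [← mul_assoc g, hg, hval] at hlim
  refine hlim.congr fun M => ?_
  have hne' : expVar c (ξ + M) ≠ expVar c (η + M) := fun h =>
    hξη (add_right_cancel (expVar_injective hc h))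
  rw [divDiffKernel, if_neg hne', ← add_sub_add_right_eq_sub ξ η M, ← halfDensity_div_sub hc]
  push_cast
  ring

theorem WhittakerPair.tendsto_diag (h : WhittakerPair μ a A B) (hμ : |μ.re| < 1 / 2)
    (hne : a ^ 2 - μ ^ 2 ≠ 0) (hc : 0 < c) {g : ℂ}
    (hg : g * (connectionGamma a μ * connectionGamma a (-μ) / (a ^ 2 - μ ^ 2)) = c) (ξ η : ℝ) :
    Tendsto (fun M : ℝ => (halfDensity c (ξ + M) (η + M) : ℂ)
      * (g * divDiffKernel A B (expVar c (ξ + M)) (expVar c (η + M)))) atTop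
      (𝓝 (diagLimit μ c (ξ - η))) := by
  rcases eq_or_ne ξ η with rfl | hξη
  · rw [diagLimit, if_pos (sub_self _)]
    exact h.tendsto_diag_self hμ hne hc hg ξ
  · rw [diagLimit, if_neg (sub_ne_zero.2 hξη)]
    exact h.tendsto_diag_of_ne hμ hne hc hg hξη

/-- The limit of an off-diagonal block of the kernel in the variables `ξ`, `η` with `ζ = ξ - η`, up
to the factor `σ / π`. -/
def crossLimit (μ a : ℂ) (c ζ : ℝ) : ℂ :=
  (crossC μ a * Complex.cosh (μ * (ζ / c : ℝ))
    - sinRatio μ * (Complex.sin (Real.pi * a) * Complex.cos (Real.pi * μ))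
      * sinhDiv μ (ζ / c : ℝ)) / (2 * c * Real.cosh (ζ / (2 * c)) : ℝ)

theorem WhittakerPair.tendsto_offDiag (h : WhittakerPair μ a A B)
    (h' : WhittakerPair μ (-a) A' B') (hμ : |μ.re| < 1 / 2) (hne : a ^ 2 - μ ^ 2 ≠ 0)
    (hc : 0 < c) (ξ η : ℝ) :
    Tendsto (fun M : ℝ => (halfDensity c (ξ + M) (η + M) : ℂ)
      * ((A (expVar c (ξ + M)) * A' (expVar c (η + M)) + (a ^ 2 - μ ^ 2)
        * (B (expVar c (ξ + M)) * B' (expVar c (η + M))))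
        / ((expVar c (ξ + M) : ℂ) + (expVar c (η + M) : ℂ)))) atTop
      (𝓝 (crossLimit μ a c (ξ - η))) := by
  have hlim := (h.tendsto_cross h' hμ hne (Real.exp_pos _) (tendsto_expVar hc ξ)
    (tendsto_expVar hc η) (expVar_eq_mul c ξ η)).div_const
    ((2 * c * Real.cosh ((ξ - η) / (2 * c)) : ℝ) : ℂ)
  rw [Real.log_exp, neg_div, Complex.ofReal_neg, sinhDiv_neg, mul_neg μ, Complex.cosh_neg,
    mul_neg _ (sinhDiv _ _), ← sub_eq_add_neg] at hlim
  refine hlim.congr fun M => ?_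
  rw [div_eq_mul_inv, ← Complex.ofReal_inv, ← add_sub_add_right_eq_sub ξ η M,
    ← halfDensity_div_add hc]
  push_cast
  ring

end LogarithmicVariable

section MainTheorem

theorem WhittakerPair.congr {μ a : ℂ} {A B A₁ B₁ : ℝ → ℂ} (h : WhittakerPair μ a A B)
    (hA : EqOn A₁ A (Ioi 0)) (hB : EqOn B₁ B (Ioi 0)) : WhittakerPair μ a A₁ B₁ where
  hasDerivAt_fst x hx := by
    rw [hA hx, hB hx]
    exact (h.hasDerivAt_fst x hx).congr_of_eventuallyEq (hA.eventuallyEq_of_mem (Ioi_mem_nhds hx))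
  hasDerivAt_snd x hx := by
    rw [hA hx, hB hx]
    exact (h.hasDerivAt_snd x hx).congr_of_eventuallyEq (hB.eventuallyEq_of_mem (Ioi_mem_nhds hx))
  tendsto_fst := h.tendsto_fst.congr'
    ((eventually_gt_atTop 0).mono fun x hx => by simp only [hA hx])
  tendsto_snd := h.tendsto_snd.congr'
    ((eventually_gt_atTop 0).mono fun x hx => by simp only [hB hx])
  isBigO_fst := h.isBigO_fst.congr'
    (eventually_mem_nhdsWithin.mono fun x hx => by simp only [hA hx]) EventuallyEq.rfl
  isBigO_snd := h.isBigO_snd.congr'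
    (eventually_mem_nhdsWithin.mono fun x hx => by simp only [hB hx]) EventuallyEq.rfl

theorem whittakerPair_whittakerW {μ : ℂ} (hμ : |μ.re| < 1 / 2) (a : ℝ) :
    WhittakerPair μ a (fun x => (((√x)⁻¹ : ℝ) : ℂ) * whittakerW (a + 1 / 2) μ x)
      fun x => (((√x)⁻¹ : ℝ) : ℂ) * whittakerW (a - 1 / 2) μ x := by
  obtain ⟨A, B, h⟩ := exists_whittakerPair hμ a
  exact h.congr (fun _ hx => h.inv_sqrt_mul_whittakerW_fst hx)
    fun _ hx => h.inv_sqrt_mul_whittakerW_snd hx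

theorem parA_add_parMu (z z' : ℂ) : parA z z' + parMu z z' = z := by
  rw [parA, parMu]
  ring

theorem parA_sub_parMu (z z' : ℂ) : parA z z' - parMu z z' = z' := by
  rw [parA, parMu]
  ring

theorem parA_sq_sub_parMu_sq (z z' : ℂ) : parA z z' ^ 2 - parMu z z' ^ 2 = z * z' := by
  rw [sq_sub_sq, parA_add_parMu, parA_sub_parMu]

variable {z z' : ℂ}

theorem Admissible.whittakerPair_plus (h : Admissible z z') :
    WhittakerPair (parMu z z') (parA z z') (Aplus z z') (Bplus z z') := by
  obtain ⟨a, ha⟩ := h.exists_parA_eq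
  have hpair := whittakerPair_whittakerW h.abs_re_parMu_lt a
  rwa [← ha] at hpair

theorem Admissible.whittakerPair_minus (h : Admissible z z') :
    WhittakerPair (parMu z z') (-parA z z') (Aminus z z') (Bminus z z') := by
  obtain ⟨a, ha⟩ := h.exists_parA_eq
  have hpair := whittakerPair_whittakerW h.abs_re_parMu_lt (-a)
  rwa [Complex.ofReal_neg, ← ha] at hpair

theorem Admissible.parA_sq_sub_ne_zero (h : Admissible z z') :
    parA z z' ^ 2 - parMu z z' ^ 2 ≠ 0 := by
  rw [parA_sq_sub_parMu_sq]
  exact h.mul_ne_zero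

theorem Admissible.sinRatio_mul_sinProd_div_pi (h : Admissible z z') :
    sinRatio (parMu z z') * sinProd z z' / Real.pi = scale z z' := by
  rw [h.ofReal_scale, scaleComplex_eq, h.sigma_sq]

theorem Admissible.inv_Gamma_mul_div_eq_scale (h : Admissible z z') :
    1 / (Complex.Gamma z * Complex.Gamma z')
      * (connectionGamma (parA z z') (parMu z z') * connectionGamma (parA z z') (-parMu z z')
        / (parA z z' ^ 2 - parMu z z' ^ 2)) = scale z z' := by
  have hΓ := inv_Gamma_mul_connectionGamma (parA z z') (parMu z z')
  rw [parA_add_parMu, parA_sub_parMu, ← sinProd, h.sinRatio_mul_sinProd_div_pi] at hΓ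
  rw [← mul_div_assoc, div_eq_iff h.parA_sq_sub_ne_zero, one_div, mul_inv, hΓ, mul_comm]

theorem Admissible.inv_Gamma_neg_mul_div_eq_scale (h : Admissible z z') :
    1 / (Complex.Gamma (-z) * Complex.Gamma (-z'))
      * (connectionGamma (-parA z z') (parMu z z') * connectionGamma (-parA z z') (-parMu z z')
        / ((-parA z z') ^ 2 - parMu z z' ^ 2)) = scale z z' := by
  have hΓ := inv_Gamma_mul_connectionGamma (-parA z z') (parMu z z')
  rw [← neg_add', ← sub_eq_neg_add, ← neg_sub (parA z z'), parA_add_parMu, parA_sub_parMu, mul_neg,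
    mul_neg, Complex.sin_neg, Complex.sin_neg, neg_mul_neg, mul_comm (Complex.sin _), ← sinProd,
    h.sinRatio_mul_sinProd_div_pi, neg_sq] at hΓ
  rw [neg_sq, ← mul_div_assoc, div_eq_iff h.parA_sq_sub_ne_zero, one_div, mul_inv,
    mul_comm (Complex.Gamma (-z))⁻¹, hΓ, mul_comm]

theorem Admissible.constB_mul_eq (h : Admissible z z') (ζ : ℝ) :
    (constB z z' : ℂ) * ζ = (ζ / (2 * scale z z') : ℝ) := by
  rw [h.constB_eq]
  push_cast
  ring

theorem Admissible.constA_mul_eq (h : Admissible z z') (ζ : ℝ) :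
    constA z z' * ζ = parMu z z' * (ζ / scale z z' : ℝ) := by
  rw [h.constA_eq_div]
  push_cast
  ring

theorem Admissible.tailF_eq_diagLimit (h : Admissible z z') (ζ : ℝ) :
    tailF z z' ζ = diagLimit (parMu z z') (scale z z') ζ := by
  have hc : (scale z z' : ℂ) ≠ 0 := Complex.ofReal_ne_zero.2 h.scale_pos.ne'
  rw [tailF, diagLimit, h.constB_mul_eq, ← Complex.ofReal_sinh]
  split_ifs with hζ hμ
  · rfl
  · rw [sinhDiv, if_pos hμ]
    push_cast
    field_simp
  · rw [h.constA_mul_eq, h.constA_eq_div, h.constB_eq, sinhDiv, if_neg hμ]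
    push_cast
    field_simp

theorem Admissible.sinRatio_parMu_eq (h : Admissible z z') :
    sinRatio (parMu z z') = Real.pi * scale z z' / (sigma z z' : ℂ) ^ 2 := by
  have hσ : (sigma z z' : ℂ) ≠ 0 := Complex.ofReal_ne_zero.2 h.sigma_pos.ne'
  have hπ : (Real.pi : ℂ) ≠ 0 := Complex.ofReal_ne_zero.2 Real.pi_ne_zero
  rw [h.ofReal_scale, scaleComplex_eq]
  field_simp

theorem Admissible.tailG_eq_crossLimit (h : Admissible z z') (ζ : ℝ) : tailG z z' ζ
    = (sigma z z' : ℂ) / Real.pi * crossLimit (parMu z z') (parA z z') (scale z z') ζ := by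
  have hc : (scale z z' : ℂ) ≠ 0 := Complex.ofReal_ne_zero.2 h.scale_pos.ne'
  have hσ : (sigma z z' : ℂ) ≠ 0 := Complex.ofReal_ne_zero.2 h.sigma_pos.ne'
  have hcosh : (Real.cosh (ζ / (2 * scale z z')) : ℂ) ≠ 0 :=
    Complex.ofReal_ne_zero.2 (Real.cosh_pos _).ne'
  have hratio := h.sinRatio_parMu_eq
  rw [tailG, crossLimit, crossC, h.constB_mul_eq, ← Complex.ofReal_cosh, Complex.ofReal_mul,
    Complex.ofReal_mul, Complex.ofReal_ofNat]
  split_ifs with hμ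
  · rw [mul_assoc 2 (constB z z' : ℂ), h.constB_mul_eq, sinhDiv, if_pos hμ]
    have hscale : (scale z z' : ℂ) = (sigma z z' : ℂ) ^ 2 / (Real.pi : ℂ) ^ 2 := by
      rw [h.ofReal_scale, scaleComplex, if_pos hμ]
    rw [hratio, hμ, zero_mul, mul_zero, Complex.cosh_zero, Complex.cos_zero]
    generalize (Real.cosh (ζ / (2 * scale z z')) : ℂ) = w at hcosh ⊢
    push_cast
    rw [hscale]
    field_simp
  · rw [h.constA_mul_eq, sinhDiv, if_neg hμ, hratio]
    field_simp

theorem Admissible.tendsto_Kpp (h : Admissible z z') (ξ η : ℝ) :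
    Tendsto (fun M : ℝ => (halfDensity (scale z z') (ξ + M) (η + M) : ℂ)
      * Kpp z z' (expVar (scale z z') (ξ + M)) (expVar (scale z z') (η + M))) atTop
      (𝓝 (tailF z z' (ξ - η))) := by
  rw [h.tailF_eq_diagLimit]
  exact h.whittakerPair_plus.tendsto_diag h.abs_re_parMu_lt h.parA_sq_sub_ne_zero h.scale_pos
    h.inv_Gamma_mul_div_eq_scale ξ η

theorem Admissible.tendsto_Kmm (h : Admissible z z') (ξ η : ℝ) :
    Tendsto (fun M : ℝ => (halfDensity (scale z z') (ξ + M) (η + M) : ℂ)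
      * Kmm z z' (expVar (scale z z') (ξ + M)) (expVar (scale z z') (η + M))) atTop
      (𝓝 (tailF z z' (ξ - η))) := by
  rw [h.tailF_eq_diagLimit]
  refine h.whittakerPair_minus.tendsto_diag h.abs_re_parMu_lt ?_ h.scale_pos
    h.inv_Gamma_neg_mul_div_eq_scale ξ η
  rw [neg_sq]
  exact h.parA_sq_sub_ne_zero

theorem Admissible.tendsto_Kpm (h : Admissible z z') (ξ η : ℝ) :
    Tendsto (fun M : ℝ => (halfDensity (scale z z') (ξ + M) (η + M) : ℂ)
      * Kpm z z' (expVar (scale z z') (ξ + M)) (expVar (scale z z') (η + M))) atTop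
      (𝓝 (tailG z z' (ξ - η))) := by
  rw [h.tailG_eq_crossLimit]
  refine ((h.whittakerPair_plus.tendsto_offDiag h.whittakerPair_minus h.abs_re_parMu_lt
    h.parA_sq_sub_ne_zero h.scale_pos ξ η).const_mul _).congr fun M => ?_
  rw [Kpm, parA_sq_sub_parMu_sq, mul_left_comm]

theorem Kmp_eq_neg_Kpm (z z' : ℂ) (x y : ℝ) : Kmp z z' x y = -Kpm z z' y x := by
  rw [Kmp, Kpm, neg_mul, add_comm (x : ℂ)]

theorem Admissible.tendsto_Kmp (h : Admissible z z') (ξ η : ℝ) :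
    Tendsto (fun M : ℝ => (halfDensity (scale z z') (ξ + M) (η + M) : ℂ)
      * Kmp z z' (expVar (scale z z') (ξ + M)) (expVar (scale z z') (η + M))) atTop
      (𝓝 (-tailG z z' (η - ξ))) :=
  (h.tendsto_Kpm η ξ).neg.congr fun M => by rw [Kmp_eq_neg_Kpm, halfDensity_comm, mul_neg]

theorem Admissible.tendsto_whittakerKernelLog (h : Admissible z z') (ξ η : ℝ) :
    Tendsto (fun M : ℝ => whittakerKernelLog z z' (ξ + M) (η + M)) atTop
      (𝓝 !![tailF z z' (ξ - η), tailG z z' (ξ - η);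
        -tailG z z' (η - ξ), tailF z z' (ξ - η)]) := by
  refine tendsto_pi_nhds.2 fun i => tendsto_pi_nhds.2 fun j => ?_
  fin_cases i <;> fin_cases j
  · exact h.tendsto_Kpp ξ η
  · exact h.tendsto_Kpm ξ η
  · exact h.tendsto_Kmp ξ η
  · exact h.tendsto_Kmm ξ η

end MainTheorem

end WhittakerTail

end

open WhittakerTail

theorem mainTheorem6 (z z' : ℂ) (h : WhittakerTail.Admissible z z') :
    (0 < WhittakerTail.sigma z z' ∧
      (WhittakerTail.sigma z z' : ℂ) ^ 2 = WhittakerTail.sinProd z z') ∧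
    (0 < WhittakerTail.scale z z' ∧
      (WhittakerTail.scale z z' : ℂ) = WhittakerTail.scaleComplex z z') ∧
    (0 < WhittakerTail.constB z z' ∧
      (WhittakerTail.constB z z' : ℂ) = WhittakerTail.constBComplex z z') ∧
    WhittakerTail.constA z z' = 2 * WhittakerTail.parMu z z' * WhittakerTail.constB z z' ∧
    ∃ 𝒦 : ℝ → ℝ → Matrix (Fin 2) (Fin 2) ℂ,
      (∀ ξ η : ℝ, Tendsto
        (fun M : ℝ => WhittakerTail.whittakerKernelLog z z' (ξ + M) (η + M))
        atTop (𝓝 (𝒦 ξ η))) ∧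
      (∀ ξ η s : ℝ, 𝒦 (ξ + s) (η + s) = 𝒦 ξ η) ∧
      (∀ ξ : ℝ, 𝒦 ξ ξ 0 0 = 1 ∧ 𝒦 ξ ξ 1 1 = 1) ∧
      (∀ ξ η : ℝ, 𝒦 ξ η =
        !![WhittakerTail.tailF z z' (ξ - η), WhittakerTail.tailG z z' (ξ - η);
           -WhittakerTail.tailG z z' (η - ξ), WhittakerTail.tailF z z' (ξ - η)]) := by
  refine ⟨⟨h.sigma_pos, h.sigma_sq⟩, ⟨h.scale_pos, h.ofReal_scale⟩,
    ⟨h.constB_pos, h.ofReal_constB⟩, by rw [h.ofReal_constB, constA_eq],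
    fun ξ η => !![tailF z z' (ξ - η), tailG z z' (ξ - η); -tailG z z' (η - ξ), tailF z z' (ξ - η)],
    h.tendsto_whittakerKernelLog, fun ξ η s => ?_, fun ξ => ?_, fun _ _ => rfl⟩
  · simp only [add_sub_add_right_eq_sub]
  · simp [tailF]
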